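/- Let $K$ be a field of characteristic zero. **Binomial sums.** For $n,k\in\mathbb Z$ put $\binom nk=\frac{n(n-1)\cdots(n-k+1)}{k!}$ if $k\ge 0$ and $\binom nk=0$ if $k<0$. For $a,b\in\mathbb Z$ the directed sum $\sum_{k=a}^{\prime\,b}u_k$ is $\sum_{k=a}^{b}u_k$ if $a\le b$, it is $0$ if $a=b+1$, and it is $-\sum_{k=b+1}^{a-1}u_k$ if $a>b+1$. Regard a sequence $u:\mathbb Z^d\to K$ as the function $(n_1,n_2,\dots)\mapsto u(n_1,\dots,n_d)$ on $\mathbb Z^{\mathbb N}$, and let $\mathcal S$ be the $K$-algebra (with pointwise operations) of all functions $\mathbb Z^{\mathbb N}\to K$ that arise in this way for some $d$; for $u\in\mathcal S$ and $\underline n\in\mathbb Z^d$ write $u_{\underline n}=u(n_1,\dots,n_d,0,0,\dots)$. The algebra $\mathcal B$ of *binomial sums* over $K$ is the smallest $K$-subalgebra of $\mathcal S$ such that 1. the sequence $n\in\mathbb Z\mapsto\delta_n$ (equal to $1$ if $n=0$ and to $0$ otherwise) is in $\mathcal B$; 2. the sequence $n\in\mathbb Z\mapsto C^n$ is in $\mathcal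 B$ for every $C\in K\setminus\{0\}$; 3. the sequence $(n,k)\in\mathbb Z^2\mapsto\binom nk$ is in $\mathcal B$; 4. if $\lambda:\mathbb Z^d\to\mathbb Z^e$ is an affine map and $u\in\mathcal B$, then $\underline n\in\mathbb Z^d\mapsto u_{\lambda(\underline n)}$ is in $\mathcal B$; 5. if $u\in\mathcal B$, then $(\underline n,m)\in\mathbb Z^d\times\mathbb Z\mapsto\sum_{k=0}^{\prime\,m}u_{\underline n,k}$ is in $\mathcal B$ (for every $d\ge 0$). A sequence $u:\mathbb Z\to K$ is a binomial sum if it is in $\mathcal B$. A sequence $u:\mathbb N\to K$ is a binomial sum if there is a binomial sum $v:\mathbb Z\to K$ with $v_n=0$ for all $n<0$ and $v_n=u_n$ for all $n\ge 0$. **Diagonals.** A *rational power series* is a formal power series $R\in K[[z_1,\dots,z_d]]$, for some $d\ge 1$, that is also a rational function, i.e. $QR=P$ for some polynomials $P,Q\in K[z_1,\dots,z_d]$ with $Q\ne 0$. The *diagonal* of $R=\sum_{\underline n\in\mathbb N^d}a_{\underline n}z_1^{n_1}\cdots z_d^{n_d}$ is the power series $\sum_{n\ge 0}a_{n,\dots,n}t^n\in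 K[[t]]$. **Theorem.** (i) A sequence $u:\mathbb N\to K$ is a binomial sum if and only if its generating function $\sum_{n\ge 0}u_nt^n$ is the diagonal of a rational power series (in some number $d\ge1$ of variables). (ii) A sequence $u:\mathbb Z\to K$ is a binomial sum if and only if both generating functions $\sum_{n\ge 0}u_nt^n$ and $\sum_{n\ge 0}u_{-n}t^n$ are diagonals of rational power series (each in some number of variables). -/

import Mathlib

noncomputable section

namespace BinomialSum

/-- The binomial coefficient `n choose k` for `n k : ℤ`: it is `n (n-1) ⋯ (n-k+1) / k!` for `k ≥ 0`
and `0` for `k < 0`. -/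
def intChoose (n k : ℤ) : ℤ :=
  if 0 ≤ k then Ring.choose n k.toNat else 0

/-- The directed sum of `u k` for `k` from `a` to `b`. For `a = b + 1` the second branch is an
empty sum, hence the value is `0`. -/
def directedSum {M : Type*} [AddCommGroup M] (a b : ℤ) (u : ℤ → M) : M :=
  if a ≤ b then ∑ k ∈ Finset.Icc a b, u k else -∑ k ∈ Finset.Icc (b + 1) (a - 1), u k

/-- A point of `ℤ^d` followed by infinitely many zeros. -/
def pad {d : ℕ} (n : Fin d → ℤ) : ℕ → ℤ :=
  fun i => if h : i < d then n ⟨i, h⟩ else 0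

/-- The embedding of the sequences `ℤ^d → K` in the functions `ℤ^ℕ → K`:
`extend u (n₀, n₁, …) = u (n₀, …, n_{d-1})`. -/
def extend {K : Type*} {d : ℕ} (u : (Fin d → ℤ) → K) : (ℕ → ℤ) → K :=
  fun n => u fun i => n i

/-- The algebra of all multi-indexed sequences: the union, over `d`, of the images of the algebras
of sequences `ℤ^d → K` in the algebra of functions `ℤ^ℕ → K`. -/
def seqAlgebra (K : Type*) [Field K] : Subalgebra K ((ℕ → ℤ) → K) where
  carrier := {f | ∃ (d : ℕ) (u : (Fin d → ℤ) → K), f = extend u}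
  mul_mem' := by
    rintro _ _ ⟨d, u, rfl⟩ ⟨e, v, rfl⟩
    exact ⟨d + e, fun n => u (fun i => n (Fin.castAdd e i)) *
      v (fun i => n ⟨i, by omega⟩), rfl⟩
  add_mem' := by
    rintro _ _ ⟨d, u, rfl⟩ ⟨e, v, rfl⟩
    exact ⟨d + e, fun n => u (fun i => n (Fin.castAdd e i)) +
      v (fun i => n ⟨i, by omega⟩), rfl⟩
  algebraMap_mem' := fun c => ⟨0, fun _ => c, rfl⟩

/-- The conditions defining binomial sums, for a subalgebra `B` of the algebra of sequences. -/
structure IsBinomialClosed {K : Type*} [Field K] (B : Subalgebra K ((ℕ → ℤ) → K)) : Prop where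
  le_seqAlgebra : B ≤ seqAlgebra K
  /-- the Kronecker delta sequence -/
  delta_mem : extend (fun n : Fin 1 → ℤ => if n 0 = 0 then (1 : K) else 0) ∈ B
  /-- the geometric sequences -/
  geom_mem : ∀ C : K, C ≠ 0 → extend (fun n : Fin 1 → ℤ => C ^ n 0) ∈ B
  /-- the binomial sequence -/
  choose_mem : extend (fun n : Fin 2 → ℤ => (intChoose (n 0) (n 1) : K)) ∈ B
  /-- closure under affine changes of indices -/
  affine_mem : ∀ (d e : ℕ) (φ : (Fin d → ℤ) →ᵃ[ℤ] (Fin e → ℤ)) (u : (ℕ → ℤ) → K), u ∈ B →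
    extend (fun n : Fin d → ℤ => u (pad (φ n))) ∈ B
  /-- closure under directed indefinite summation: the last of the `d + 1` indices is the upper
  bound of the summation -/
  sum_mem : ∀ (d : ℕ) (u : (ℕ → ℤ) → K), u ∈ B →
    extend (fun n : Fin (d + 1) → ℤ => directedSum 0 (n (Fin.last d)) fun k : ℤ =>
      u (pad (Fin.snoc (α := fun _ => ℤ) (Fin.init n) k : Fin (d + 1) → ℤ))) ∈ B

/-- The algebra of binomial sums: the smallest subalgebra of the algebra of sequences that
satisfies the conditions above. -/
def binomialSums (K : Type*) [Field K] : Subalgebra K ((ℕ → ℤ) → K) :=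
  sInf {B | IsBinomialClosed B}

/-- The smallest subalgebra indeed exists, and it is `binomialSums K`. -/
theorem isLeast_binomialSums (K : Type*) [Field K] :
    IsLeast {B : Subalgebra K ((ℕ → ℤ) → K) | IsBinomialClosed B} (binomialSums K) := by
  have hS : IsBinomialClosed (seqAlgebra K) :=
    { le_seqAlgebra := le_rfl
      delta_mem := ⟨_, _, rfl⟩
      geom_mem := fun _ _ => ⟨_, _, rfl⟩
      choose_mem := ⟨_, _, rfl⟩
      affine_mem := fun _ _ _ _ _ => ⟨_, _, rfl⟩
      sum_mem := fun _ _ _ => ⟨_, _, rfl⟩ }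
  refine ⟨?_, fun B hB => sInf_le hB⟩
  have h : ∀ f, f ∈ binomialSums K ↔ ∀ B ∈ {B | IsBinomialClosed B}, f ∈ B :=
    fun f => Algebra.mem_sInf
  exact
    { le_seqAlgebra := sInf_le hS
      delta_mem := (h _).2 fun B hB => hB.delta_mem
      geom_mem := fun C hC => (h _).2 fun B hB => hB.geom_mem C hC
      choose_mem := (h _).2 fun B hB => hB.choose_mem
      affine_mem := fun d e φ u hu => (h _).2 fun B hB => hB.affine_mem d e φ u ((h u).1 hu B hB)
      sum_mem := fun d u hu => (h _).2 fun B hB => hB.sum_mem d u ((h u).1 hu B hB) }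

/-- A sequence `ℤ → K` is a binomial sum. -/
def IsBinomialSum {K : Type*} [Field K] (u : ℤ → K) : Prop :=
  extend (fun n : Fin 1 → ℤ => u (n 0)) ∈ binomialSums K

/-- A sequence `ℕ → K` is a binomial sum: it is the restriction of a binomial sum `ℤ → K` whose
support is contained in `ℕ`. -/
def IsBinomialSumNat {K : Type*} [Field K] (u : ℕ → K) : Prop :=
  ∃ v : ℤ → K, IsBinomialSum v ∧ (∀ n : ℤ, n < 0 → v n = 0) ∧ ∀ n : ℕ, v n = u n

/-- A rational power series in `d` variables: a power series equal to a quotient `P / Q` of two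
polynomials, `Q ≠ 0`. The constant term of `Q` is allowed to vanish. -/
def IsRationalSeries {K : Type*} [Field K] {d : ℕ} (R : MvPowerSeries (Fin d) K) : Prop :=
  ∃ P Q : MvPolynomial (Fin d) K, Q ≠ 0 ∧
    (Q : MvPowerSeries (Fin d) K) * R = (P : MvPowerSeries (Fin d) K)

/-- The diagonal `∑ₙ a_{n,…,n} tⁿ` of the power series `∑ a_{n₁,…,n_d} z₁^{n₁} ⋯ z_d^{n_d}`. -/
def diag {K : Type*} [Field K] {d : ℕ} (R : MvPowerSeries (Fin d) K) : PowerSeries K :=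
  PowerSeries.mk fun n => MvPowerSeries.coeff (Finsupp.equivFunOnFinite.symm fun _ => n) R

/-- The power series `f` is the diagonal of a rational power series in `d ≥ 1` variables. -/
def IsRationalDiagonal {K : Type*} [Field K] (f : PowerSeries K) : Prop :=
  ∃ d : ℕ, 1 ≤ d ∧ ∃ R : MvPowerSeries (Fin d) K, IsRationalSeries R ∧ f = diag R

end BinomialSum

end

/-! From diagonals to binomial sums: by Krull's intersection theorem a rational power series
satisfies `(1 - r) * R = S` with polynomials `r`, `S` and `r` without constant term
(`IsRationalSeries.exists_one_sub_mul`). Hence the coefficient of `R` at `(n, …, n)` is a sum over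
`0 ≤ k ≤ d * n` of coefficients of `r ^ k * S`, and repeated use of the binomial theorem writes the
coefficients of `r ^ k` as binomial sums in `k` and the exponent (`isBinomialFun_powCoeff`).

From binomial sums to diagonals: every binomial sum is a linear combination of constant terms `[1]
(S * R₁ ^ n₁ * ⋯ * R_d ^ n_d)` of rational functions expanded as Hahn series. Products are handled
by taking lexicographic products of the exponent groups, which separates variables, and directed
sums by summing geometric progressions (`sum_mem_constantTermSums`). For one index, a change of
basis of the exponent group turns `[1] (x * y ^ n)` into the coefficient of `f * g ^ n` at `a + n •
b`, where `f`, `g` are rational power series (`isRationalDiagonal_coeff_zero_mul_pow`). Such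
coefficients lie on a ray in the coefficients of a rational series in one more variable, and a ray
can be rescaled to the diagonal (`IsRationalSeries.weightedSection`). -/

noncomputable section

namespace BinomialSum

/-! ### Closure properties of binomial sums indexed by abelian groups -/

section Closure

variable {K : Type*} [Field K]

theorem isBinomialClosed_binomialSums : IsBinomialClosed (binomialSums K) :=
  (isLeast_binomialSums K).1

theorem extend_pad {K : Type*} {d : ℕ} (u : (Fin d → ℤ) → K) (n : Fin d → ℤ) : extend u (pad n) = u n := by
  simp [extend, pad]

/-- A function on an abelian group is a binomial function if it is a binomial sum composed with an
affine map. -/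
def IsBinomialFun {V : Type*} [AddCommGroup V] (u : V → K) : Prop :=
  ∃ (d : ℕ) (φ : V →ᵃ[ℤ] (Fin d → ℤ)) (w : (Fin d → ℤ) → K),
    extend w ∈ binomialSums K ∧ ∀ v, u v = w (φ v)

variable {V W : Type*} [AddCommGroup V] [AddCommGroup W]

theorem extend_comp_mem {d e : ℕ} {w : (Fin e → ℤ) → K} (hw : extend w ∈ binomialSums K)
    (φ : (Fin d → ℤ) →ᵃ[ℤ] (Fin e → ℤ)) : extend (fun n => w (φ n)) ∈ binomialSums K := by
  simpa only [extend_pad] using isBinomialClosed_binomialSums.affine_mem d e φ _ hw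

theorem IsBinomialFun.comp {u : W → K} (hu : IsBinomialFun u) (ψ : V →ᵃ[ℤ] W) :
    IsBinomialFun fun v => u (ψ v) := by
  obtain ⟨d, φ, w, hw, h⟩ := hu
  exact ⟨d, φ.comp ψ, w, hw, fun v => h _⟩

theorem IsBinomialFun.isBinomialSum {u : ℤ → K} (hu : IsBinomialFun u) : IsBinomialSum u := by
  obtain ⟨d, φ, w, hw, h⟩ := hu
  have := extend_comp_mem hw
    (φ.comp (LinearMap.proj (R := ℤ) (φ := fun _ : Fin 1 => ℤ) 0).toAffineMap)
  simpa [IsBinomialSum, h] using this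

theorem IsBinomialFun.of_extend {d : ℕ} {w : (Fin d → ℤ) → K} (hw : extend w ∈ binomialSums K) :
    IsBinomialFun w :=
  ⟨d, AffineMap.id ℤ _, w, hw, fun _ => rfl⟩

/-- A binary operation preserving binomial sums preserves binomial functions. -/
theorem IsBinomialFun.map₂ (F : K → K → K)
    (hF : ∀ f ∈ binomialSums K, ∀ g ∈ binomialSums K, (fun n => F (f n) (g n)) ∈ binomialSums K)
    {u v : V → K} (hu : IsBinomialFun u) (hv : IsBinomialFun v) :
    IsBinomialFun fun x => F (u x) (v x) := by
  obtain ⟨d, φ, w, hw, h⟩ := hu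
  obtain ⟨e, ψ, w', hw', h'⟩ := hv
  let a : (Fin (d + e) → ℤ) →ᵃ[ℤ] (Fin d → ℤ) :=
    (LinearMap.funLeft ℤ ℤ (Fin.castAdd e)).toAffineMap
  let b : (Fin (d + e) → ℤ) →ᵃ[ℤ] (Fin e → ℤ) :=
    (LinearMap.funLeft ℤ ℤ (Fin.natAdd d)).toAffineMap
  refine ⟨d + e, AffineMap.pi fun i => Fin.addCases
    (fun i => (LinearMap.proj (R := ℤ) (φ := fun _ => ℤ) i).toAffineMap.comp φ)
    (fun i => (LinearMap.proj (R := ℤ) (φ := fun _ => ℤ) i).toAffineMap.comp ψ) i,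
    fun n => F (w (a n)) (w' (b n)), ?_, fun x => ?_⟩
  · exact hF _ (extend_comp_mem hw a) _ (extend_comp_mem hw' b)
  · have h1 : ∀ f, a f = fun i => f (Fin.castAdd e i) := fun f => rfl
    have h2 : ∀ f, b f = fun i => f (Fin.natAdd d i) := fun f => rfl
    simp [h1, h2, h, h']

theorem IsBinomialFun.add {u v : V → K} (hu : IsBinomialFun u) (hv : IsBinomialFun v) :
    IsBinomialFun fun x => u x + v x :=
  IsBinomialFun.map₂ (· + ·) (fun _ hf _ hg => add_mem hf hg) hu hv

theorem IsBinomialFun.mul {u v : V → K} (hu : IsBinomialFun u) (hv : IsBinomialFun v) :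
    IsBinomialFun fun x => u x * v x :=
  IsBinomialFun.map₂ (· * ·) (fun _ hf _ hg => mul_mem hf hg) hu hv

theorem IsBinomialFun.const (c : K) : IsBinomialFun fun _ : V => c :=
  ⟨0, AffineMap.const ℤ _ 0, fun _ => c, (binomialSums K).algebraMap_mem c, fun _ => rfl⟩

theorem IsBinomialFun.finset_sum {ι : Type*} (s : Finset ι) {u : ι → V → K}
    (hu : ∀ i ∈ s, IsBinomialFun (u i)) : IsBinomialFun fun x => ∑ i ∈ s, u i x := by
  classical
  induction s using Finset.induction_on with
  | empty => simpa using IsBinomialFun.const 0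
  | insert i s hi ih =>
    simp only [Finset.sum_insert hi]
    exact (hu i (by simp)).add (ih fun j hj => hu j (by simp [hj]))

theorem IsBinomialFun.finset_prod {ι : Type*} (s : Finset ι) {u : ι → V → K}
    (hu : ∀ i ∈ s, IsBinomialFun (u i)) : IsBinomialFun fun x => ∏ i ∈ s, u i x := by
  classical
  induction s using Finset.induction_on with
  | empty => simpa using IsBinomialFun.const 1
  | insert i s hi ih =>
    simp only [Finset.prod_insert hi]
    exact (hu i (by simp)).mul (ih fun j hj => hu j (by simp [hj]))

theorem isBinomialFun_delta : IsBinomialFun fun n : ℤ => if n = 0 then (1 : K) else 0 :=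
  (IsBinomialFun.of_extend isBinomialClosed_binomialSums.delta_mem).comp
    (LinearMap.pi fun _ : Fin 1 => LinearMap.id (R := ℤ) (M := ℤ)).toAffineMap

theorem isBinomialFun_zpow {c : K} (hc : c ≠ 0) : IsBinomialFun fun n : ℤ => c ^ n :=
  (IsBinomialFun.of_extend (isBinomialClosed_binomialSums.geom_mem c hc)).comp
    (LinearMap.pi fun _ : Fin 1 => LinearMap.id (R := ℤ) (M := ℤ)).toAffineMap

theorem isBinomialFun_choose : IsBinomialFun fun n : ℤ × ℤ => (intChoose n.1 n.2 : K) :=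
  (IsBinomialFun.of_extend isBinomialClosed_binomialSums.choose_mem).comp
    (LinearMap.pi ![LinearMap.fst ℤ ℤ ℤ, LinearMap.snd ℤ ℤ ℤ]).toAffineMap

/-- An affine map of `(v, k)` has the form `φ₀ v + k • b`. Substituting `x + k • b` in the binomial
sum makes `k` the last coordinate, as the summation axiom requires; the result is then pulled back
along `v ↦ (φ₀ v, l v)`. -/
theorem IsBinomialFun.directedSum {u : V × ℤ → K} (hu : IsBinomialFun u) (l : V →ᵃ[ℤ] ℤ) :
    IsBinomialFun fun v => directedSum 0 (l v) fun k => u (v, k) := by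
  obtain ⟨d, φ, w, hw, h⟩ := hu
  let φ₀ : V →ᵃ[ℤ] (Fin d → ℤ) := φ.comp ((AffineMap.id ℤ V).prod (AffineMap.const ℤ V 0))
  let b : Fin d → ℤ := φ.linear (0, 1)
  have hφ : ∀ v k, φ (v, k) = φ₀ v + k • b := by
    intro v k
    have := φ.map_vadd (v, 0) (0, k)
    simp only [vadd_eq_add, Prod.mk_add_mk, zero_add, add_zero] at this
    rw [this, show ((0 : V), k) = k • ((0 : V), (1 : ℤ)) by simp, map_smul, add_comm]
    rfl
  let σ : (Fin (d + 1) → ℤ) →ᵃ[ℤ] (Fin d → ℤ) :=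
    (LinearMap.pi fun i => LinearMap.proj (R := ℤ) (φ := fun _ : Fin (d + 1) => ℤ) i.castSucc +
      b i • LinearMap.proj (R := ℤ) (φ := fun _ : Fin (d + 1) => ℤ) (Fin.last d)).toAffineMap
  have hσ : ∀ (x : Fin d → ℤ) (k : ℤ), σ (Fin.snoc (α := fun _ => ℤ) x k) = x + k • b := by
    intro x k
    ext i
    simp [σ, mul_comm]
  have key := isBinomialClosed_binomialSums.sum_mem d _ (extend_comp_mem hw σ)
  simp only [extend_pad, hσ] at key
  let ψ : V →ᵃ[ℤ] (Fin (d + 1) → ℤ) := AffineMap.pi fun i => Fin.lastCases l (fun i =>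
    (LinearMap.proj (R := ℤ) (φ := fun _ => ℤ) i).toAffineMap.comp φ₀) i
  have h1 : ∀ v, Fin.init (ψ v) = φ₀ v := fun v => by
    ext i
    simp [Fin.init, ψ]
  have h2 : ∀ v, ψ v (Fin.last d) = l v := fun v => by simp [ψ]
  exact ⟨d + 1, ψ, _, key, fun v => by simp only [h, hφ, h1, h2]⟩

theorem directedSum_of_nonneg {M : Type*} [AddCommGroup M] (n : ℕ) (u : ℤ → M) :
    directedSum 0 (n : ℤ) u = ∑ k ∈ Finset.range (n + 1), u k := by
  rw [BinomialSum.directedSum, if_pos (by positivity)]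
  symm
  refine Finset.sum_bij (fun k _ => (k : ℤ)) ?_ (by simp) ?_ (by simp)
  · intro k hk
    simp at hk ⊢
    omega
  · intro k hk
    simp at hk
    exact ⟨k.toNat, by simp; omega, by simp [hk.1]⟩

theorem directedSum_of_neg {M : Type*} [AddCommGroup M] {n : ℤ} (hn : n < 0) (u : ℤ → M) :
    directedSum 0 n u = -∑ k ∈ Finset.Icc (n + 1) (-1), u k := by
  rw [BinomialSum.directedSum, if_neg (by omega)]
  simp

/-- This is the directed sum of the delta sequence: for negative `n` the range `n + 1, …, -1` misses
`0`. -/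
theorem isBinomialFun_nonneg : IsBinomialFun fun n : ℤ => if 0 ≤ n then (1 : K) else 0 := by
  have h := (isBinomialFun_delta (K := K)).comp (LinearMap.snd ℤ ℤ ℤ).toAffineMap
  have h' := h.directedSum (AffineMap.id ℤ ℤ)
  convert h' using 2 with n
  simp only [AffineMap.id_apply, LinearMap.coe_toAffineMap, LinearMap.snd_apply]
  rcases le_or_gt 0 n with hn | hn
  · lift n to ℕ using hn
    rw [directedSum_of_nonneg]
    simp
  · rw [directedSum_of_neg hn, if_neg (by omega), Finset.sum_eq_zero, neg_zero]
    intro k hk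
    simp at hk
    exact if_neg (by omega)

end Closure

/-! ### Diagonals of rational power series are binomial sums -/

section Coefficients

variable {K : Type*} [Field K] {V W : Type*} [AddCommGroup V] [AddCommGroup W]

theorem IsBinomialFun.comp_add_const {u : W → K} (hu : IsBinomialFun u) (f : V → W)
    (hf : ∀ x y, f (x + y) = f x + f y) (c : W) : IsBinomialFun fun v => u (f v + c) :=
  hu.comp ((AddMonoidHom.mk' f hf).toIntLinearMap.toAffineMap + AffineMap.const ℤ V c)

theorem IsBinomialFun.comp_add {u : W → K} (hu : IsBinomialFun u) (f : V → W)
    (hf : ∀ x y, f (x + y) = f x + f y) : IsBinomialFun fun v => u (f v) :=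
  hu.comp (AddMonoidHom.mk' f hf).toIntLinearMap.toAffineMap

open MvPowerSeries in
/-- A rational power series is a quotient of two polynomials whose denominator has constant
coefficient `1`. -/
theorem IsRationalSeries.exists_one_sub_mul {d : ℕ} {R : MvPowerSeries (Fin d) K}
    (hR : IsRationalSeries R) : ∃ S r : MvPolynomial (Fin d) K, MvPolynomial.constantCoeff r = 0 ∧
      (1 - (r : MvPowerSeries (Fin d) K)) * R = S := by
  obtain ⟨P, Q, hQ, h⟩ := hR
  let I := MvPolynomial.idealOfVars (Fin d) K
  let M := MvPolynomial (Fin d) K ⧸ Ideal.span {Q}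
  -- Modulo `Q`, `P` is congruent to `P - Q * truncTotal n R`, which has no terms of degree below
  -- `n` because `P = Q * R`.
  have key : (Ideal.Quotient.mk (Ideal.span {Q}) P : M) ∈ (⨅ i : ℕ, I ^ i • ⊤ : Submodule (MvPolynomial (Fin d) K) M) := by
    rw [Submodule.mem_iInf]
    intro n
    have h2 : P - Q * truncTotal n R ∈ I ^ n := by
      classical
      rw [MvPolynomial.mem_pow_idealOfVars_iff']
      intro x hx
      rw [MvPolynomial.coeff_sub, sub_eq_zero, MvPolynomial.coeff_mul, ← MvPolynomial.coeff_coe,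
        ← h, coeff_mul]
      refine Finset.sum_congr rfl fun y hy => ?_
      rw [MvPolynomial.coeff_coe, coeff_truncTotal]
      exact (Finsupp.degree_mono (Finset.HasAntidiagonal.antidiagonal.snd_le hy)).trans_lt hx
    have h3 : (Ideal.Quotient.mk (Ideal.span {Q}) P : M) =
        (P - Q * truncTotal n R) • (1 : M) := by
      change _ = Ideal.Quotient.mk (Ideal.span {Q}) ((P - Q * truncTotal n R) * 1)
      rw [mul_one, Ideal.Quotient.eq]
      simp [Ideal.mem_span_singleton]
    rw [h3]
    exact Submodule.smul_mem_smul h2 trivial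
  -- Krull's intersection theorem: some `r` without constant term fixes the class of `P`, so `Q`
  -- divides `(1 - r) * P`.
  rw [Ideal.mem_iInf_smul_pow_eq_bot_iff] at key
  obtain ⟨⟨r, hr⟩, hrP⟩ := key
  have h1 : (1 - r) * P ∈ Ideal.span {Q} := by
    rw [← Ideal.Quotient.eq_zero_iff_mem]
    change Ideal.Quotient.mk (Ideal.span {Q}) (r * P) = _ at hrP
    rw [sub_mul, one_mul, map_sub]
    exact sub_eq_zero.2 hrP.symm
  obtain ⟨S, hS⟩ := Ideal.mem_span_singleton.1 h1
  refine ⟨S, r, ?_, ?_⟩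
  · have := (MvPolynomial.mem_pow_idealOfVars_iff' 1 r).1 (by simpa using hr) 0 (by simp)
    exact this
  · have hQ' : (Q : MvPowerSeries (Fin d) K) ≠ 0 := by simpa using hQ
    apply mul_left_cancel₀ hQ'
    rw [mul_left_comm, h, ← MvPolynomial.coe_mul, ← hS, MvPolynomial.coe_mul,
      ← MvPolynomial.coeToMvPowerSeries.ringHom_apply (φ := 1 - r), map_sub, map_one]
    rfl

/-- The coefficient of a power series at an integral exponent, `0` if some entry is negative. -/
def intCoeff {d : ℕ} (f : MvPowerSeries (Fin d) K) (n : Fin d → ℤ) : K :=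
  if ∀ i, 0 ≤ n i then
    MvPowerSeries.coeff (Finsupp.equivFunOnFinite.symm fun i => (n i).toNat) f else 0

/-- Extension by zero to negative exponents makes the shift hold without the condition `α ≤ n`, so
that it is an affine change of indices. -/
theorem intCoeff_monomial_mul {d : ℕ} (α : Fin d →₀ ℕ) (c : K) (f : MvPowerSeries (Fin d) K)
    (n : Fin d → ℤ) : intCoeff (MvPowerSeries.monomial α c * f) n =
      c * intCoeff f (n - fun i => (α i : ℤ)) := by
  simp only [intCoeff, MvPowerSeries.coeff_monomial_mul]
  by_cases h : ∀ i, (α i : ℤ) ≤ n i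
  · rw [if_pos fun i => (Nat.cast_nonneg _).trans (h i), if_pos, if_pos fun i => by simpa using h i]
    · congr 3
      ext i
      simp
    · intro i
      have := h i
      simp
      omega
  · rw [if_neg (c := ∀ i, 0 ≤ (n - fun i => (α i : ℤ)) i) (by simpa using h), mul_zero]
    split_ifs with h1 h2
    · exfalso
      refine h fun i => ?_
      have := h2 i
      have := h1 i
      simp at *
      omega
    · rfl
    · rfl

theorem intCoeff_sum {d : ℕ} {ι : Type*} (s : Finset ι) (f : ι → MvPowerSeries (Fin d) K)
    (n : Fin d → ℤ) : intCoeff (∑ i ∈ s, f i) n = ∑ i ∈ s, intCoeff (f i) n := by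
  simp only [intCoeff]
  split_ifs <;> simp

theorem intCoeff_smul {d : ℕ} (c : K) (f : MvPowerSeries (Fin d) K) (n : Fin d → ℤ) :
    intCoeff (c • f) n = c * intCoeff f n := by
  simp only [intCoeff]
  split_ifs <;> simp

/-- The coefficients of the powers of `p`, as a function of the exponents. -/
def powCoeff {d : ℕ} (p : MvPolynomial (Fin d) K) (x : ℤ × (Fin d → ℤ)) : K :=
  if 0 ≤ x.1 then intCoeff ((p : MvPowerSeries (Fin d) K) ^ x.1.toNat) x.2 else 0

/-- Since `0 ^ 0 = 1`, the function is a product of delta sequences in `k` and the entries of the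
exponent. -/
theorem isBinomialFun_powCoeff_zero {d : ℕ} :
    IsBinomialFun (powCoeff (0 : MvPolynomial (Fin d) K)) := by
  have h := ((isBinomialFun_delta (K := K)).comp_add (fun x : ℤ × (Fin d → ℤ) => x.1)
    (fun _ _ => rfl)).mul (IsBinomialFun.finset_prod Finset.univ fun i _ =>
      (isBinomialFun_delta (K := K)).comp_add (fun x : ℤ × (Fin d → ℤ) => x.2 i) fun _ _ => rfl)
  convert h using 2 with x
  obtain ⟨k, n⟩ := x
  simp only [powCoeff]
  rcases lt_trichotomy k 0 with hk | rfl | hk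
  · simp [hk.ne, hk.not_ge]
  · classical
    simp only [le_refl, if_true, one_mul, Int.toNat_zero, pow_zero, intCoeff,
      MvPowerSeries.coeff_one]
    by_cases hn : n = 0
    · subst hn
      rw [if_pos (by simp), if_pos (by ext; simp)]
      simp
    · have : ∃ i, n i ≠ 0 := by
        by_contra! h
        exact hn (funext h)
      obtain ⟨i, hi⟩ := this
      rw [Finset.prod_eq_zero (Finset.mem_univ i) (if_neg hi)]
      split_ifs with h1 h2
      · have h3 := DFunLike.congr_fun h2 i
        have h4 := h1 i
        simp at h3
        omega
      · rfl
      · rfl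
  · have : k.toNat ≠ 0 := by omega
    simp [hk.ne', hk.le, this, intCoeff]

/-- By the binomial theorem the coefficient of `(c z^α + p) ^ k` at `n` is the sum over `0 ≤ j ≤ k`
of `choose k j * c ^ (k - j)` times the coefficient of `p ^ j` at `n - (k - j) α`; all arguments are
linear in `(k, n, j)`. The indicator of `0 ≤ k` removes the negative `k`. -/
theorem IsBinomialFun.powCoeff_monomial_add {d : ℕ} (α : Fin d →₀ ℕ) {c : K} (hc : c ≠ 0)
    {p : MvPolynomial (Fin d) K} (hp : IsBinomialFun (powCoeff p)) :
    IsBinomialFun (powCoeff (MvPolynomial.monomial α c + p)) := by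
  have h1 := (isBinomialFun_choose (K := K)).comp_add (fun x : (ℤ × (Fin d → ℤ)) × ℤ => (x.1.1, x.2))
    (fun _ _ => rfl)
  have h2 := (isBinomialFun_zpow hc).comp_add (fun x : (ℤ × (Fin d → ℤ)) × ℤ => x.1.1 - x.2)
    (fun _ _ => by simp; ring)
  have h3 := hp.comp_add
    (fun x : (ℤ × (Fin d → ℤ)) × ℤ => (x.2, x.1.2 - fun i => (x.1.1 - x.2) * (α i : ℤ)))
    (fun _ _ => by
      ext
      · simp
      · simp; ring)
  have h4 := ((h1.mul h2).mul h3).directedSum (LinearMap.fst ℤ ℤ (Fin d → ℤ)).toAffineMap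
  have h5 := ((isBinomialFun_nonneg (K := K)).comp_add (fun x : ℤ × (Fin d → ℤ) => x.1) fun _ _ => rfl).mul h4
  convert h5 using 2 with x
  obtain ⟨k, n⟩ := x
  simp only [LinearMap.coe_toAffineMap, LinearMap.fst_apply]
  rcases lt_or_ge k 0 with hk | hk
  · simp [powCoeff, hk.not_ge]
  lift k to ℕ using hk
  rw [directedSum_of_nonneg]
  simp only [powCoeff, MvPolynomial.coe_add, MvPolynomial.coe_monomial, Nat.cast_nonneg, if_true,
    one_mul, Int.toNat_natCast]
  rw [add_comm, add_pow, intCoeff_sum]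
  refine Finset.sum_congr rfl fun j hj => ?_
  have hj' : j ≤ k := by simpa [Nat.lt_succ_iff] using hj
  rw [MvPowerSeries.monomial_pow, mul_comm, mul_comm (_ ^ j), ← nsmul_eq_mul,
    ← Nat.cast_smul_eq_nsmul K, intCoeff_smul, intCoeff_monomial_mul, ← mul_assoc, ← Nat.cast_sub hj',
    zpow_natCast]
  congr 2
  simp [intChoose, Ring.choose_natCast]

theorem isBinomialFun_powCoeff {d : ℕ} (p : MvPolynomial (Fin d) K) :
    IsBinomialFun (powCoeff p) := by
  induction p using MvPolynomial.monomial_add_induction_on with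
  | C a =>
    rcases eq_or_ne a 0 with rfl | ha
    · simpa using isBinomialFun_powCoeff_zero
    · simpa using isBinomialFun_powCoeff_zero.powCoeff_monomial_add 0 ha
  | monomial_add α c p _ hc hp => exact hp.powCoeff_monomial_add α hc

open MvPowerSeries in
-- Iterating `R = S + r * R` leaves the remainder `r ^ m * R`, whose order is at least `m`.
theorem coeff_eq_sum_of_one_sub_mul {d : ℕ} {R S r : MvPowerSeries (Fin d) K}
    (hr : constantCoeff r = 0) (h : (1 - r) * R = S) (v : Fin d →₀ ℕ) {m : ℕ} (hm : v.degree < m) :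
    coeff v R = ∑ k ∈ Finset.range m, coeff v (r ^ k * S) := by
  have h1 : R = ∑ k ∈ Finset.range m, r ^ k * S + r ^ m * R := by
    have := geom_sum_mul_neg r m
    rw [← Finset.sum_mul, ← h, ← mul_assoc, this]
    ring
  conv_lhs => rw [h1]
  rw [map_add, map_sum, coeff_of_lt_order (f := r ^ m * R), add_zero]
  calc (v.degree : ℕ∞) < m := by exact_mod_cast hm
    _ ≤ (r ^ m).order := le_order_pow_of_constantCoeff_eq_zero m hr
    _ ≤ (r ^ m).order + R.order := le_self_add
    _ ≤ _ := le_order_mul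

/-- The diagonal coefficients of a rational power series, extended by `0`, form a binomial sum. -/
theorem IsRationalSeries.isBinomialSum_diag {d : ℕ} {R : MvPowerSeries (Fin d) K}
    (hR : IsRationalSeries R) :
    IsBinomialSum fun n : ℤ => if 0 ≤ n then PowerSeries.coeff n.toNat (diag R) else 0 := by
  obtain ⟨S, r, hr, h⟩ := hR.exists_one_sub_mul
  -- The exponent `(n, …, n)` has degree `d * n`, so powers of `r` up to `d * n` suffice, a bound
  -- linear in `n`. Each monomial `β` of `S` contributes a shift of the exponent by `-β`.
  have h1 := fun β : Fin d →₀ ℕ => ((isBinomialFun_powCoeff r).comp_add_const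
    (fun x : ℤ × ℤ => (x.2, fun _ : Fin d => x.1)) (fun _ _ => rfl)
      (0, -fun i => (β i : ℤ))).directedSum ((d : ℤ) • LinearMap.id (R := ℤ) (M := ℤ)).toAffineMap
  have h2 := ((isBinomialFun_nonneg (K := K)).mul (IsBinomialFun.finset_sum S.support fun β _ =>
    (IsBinomialFun.const (S.coeff β)).mul (h1 β))).isBinomialSum
  convert h2 using 2 with n
  rcases lt_or_ge n 0 with hn | hn
  · simp [hn.not_ge]
  lift n to ℕ using hn
  simp only [diag, Nat.cast_nonneg, if_true, Int.toNat_natCast, PowerSeries.coeff_mk, one_mul]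
  rw [coeff_eq_sum_of_one_sub_mul
    (by rwa [← MvPowerSeries.coeff_zero_eq_constantCoeff_apply, MvPolynomial.coeff_coe]) h _ (m := d * n + 1)]
  swap
  · rw [Finsupp.degree_eq_sum]
    simp
  have h3 : ∀ f : MvPowerSeries (Fin d) K, MvPowerSeries.coeff
      (Finsupp.equivFunOnFinite.symm fun _ => n) f = intCoeff f fun _ => (n : ℤ) := by
    intro f
    simp [intCoeff]
  have h4 : ∀ k : ℕ, intCoeff ((r : MvPowerSeries (Fin d) K) ^ k * (S : MvPowerSeries (Fin d) K)) (fun _ => (n : ℤ)) =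
      ∑ β ∈ S.support, S.coeff β * powCoeff r (((k : ℤ), fun _ : Fin d => (n : ℤ)) + (0, -fun i => (β i : ℤ))) := by
    intro k
    have : (S : MvPowerSeries (Fin d) K) =
        ∑ β ∈ S.support, MvPowerSeries.monomial β (S.coeff β) := by
      conv_lhs => rw [S.as_sum]
      rw [← MvPolynomial.coeToMvPowerSeries.ringHom_apply, map_sum]
      simp
    conv_lhs => rw [this]
    rw [mul_comm, Finset.sum_mul, intCoeff_sum]
    refine Finset.sum_congr rfl fun β _ => ?_
    rw [intCoeff_monomial_mul]
    simp [powCoeff, sub_eq_add_neg]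
  simp only [h3, h4]
  rw [Finset.sum_comm]
  refine Finset.sum_congr rfl fun β _ => ?_
  rw [← Finset.mul_sum, show ((d : ℤ) • LinearMap.id (R := ℤ) (M := ℤ)).toAffineMap (n : ℤ) =
    ((d * n : ℕ) : ℤ) by simp, directedSum_of_nonneg]

end Coefficients

/-! ### Rational power series: geometric progressions, sections along rays, diagonals -/

section Rational

open MvPowerSeries

variable {K : Type*} [Field K] {d : ℕ}

theorem isRationalSeries_coe (P : MvPolynomial (Fin d) K) :
    IsRationalSeries (P : MvPowerSeries (Fin d) K) :=
  ⟨P, 1, one_ne_zero, by simp⟩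

theorem IsRationalSeries.mul {R S : MvPowerSeries (Fin d) K} (hR : IsRationalSeries R)
    (hS : IsRationalSeries S) : IsRationalSeries (R * S) := by
  obtain ⟨P, Q, hQ, h⟩ := hR
  obtain ⟨P', Q', hQ', h'⟩ := hS
  refine ⟨P * P', Q * Q', mul_ne_zero hQ hQ', ?_⟩
  rw [MvPolynomial.coe_mul, MvPolynomial.coe_mul, ← h, ← h']
  ring

theorem IsRationalSeries.add {R S : MvPowerSeries (Fin d) K} (hR : IsRationalSeries R)
    (hS : IsRationalSeries S) : IsRationalSeries (R + S) := by
  obtain ⟨P, Q, hQ, h⟩ := hR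
  obtain ⟨P', Q', hQ', h'⟩ := hS
  refine ⟨P * Q' + P' * Q, Q * Q', mul_ne_zero hQ hQ', ?_⟩
  simp only [MvPolynomial.coe_mul, MvPolynomial.coe_add, ← h, ← h']
  ring

/-- The power series in `d + 1` variables whose coefficients with respect to the first variable
are the power series `h n`. -/
def stack (h : ℕ → MvPowerSeries (Fin d) K) : MvPowerSeries (Fin (d + 1)) K :=
  fun v => coeff v.tail (h (v 0))

theorem coeff_stack (h : ℕ → MvPowerSeries (Fin d) K) (v : Fin (d + 1) →₀ ℕ) :
    coeff v (stack h) = coeff v.tail (h (v 0)) :=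
  rfl

theorem stack_add (h h' : ℕ → MvPowerSeries (Fin d) K) :
    stack (fun n => h n + h' n) = stack h + stack h' := by
  ext v
  simp [coeff_stack]

theorem stack_sub (h h' : ℕ → MvPowerSeries (Fin d) K) :
    stack (fun n => h n - h' n) = stack h - stack h' := by
  ext v
  simp [coeff_stack]

theorem X_zero_mul_stack (h : ℕ → MvPowerSeries (Fin d) K) :
    X 0 * stack h = stack fun n => if n = 0 then 0 else h (n - 1) := by
  ext v
  rw [X, coeff_monomial_mul, coeff_stack, coeff_stack]
  by_cases hv : v 0 = 0
  · rw [if_pos hv, if_neg, coeff_zero]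
    intro hle
    have := hle 0
    simp at this
    omega
  · rw [if_neg hv, if_pos, one_mul]
    · congr 2
      · ext i
        simp [Finsupp.tail_apply]
      · simp
    · rw [Finsupp.single_le_iff]
      omega

theorem X_succ_mul_stack (i : Fin d) (h : ℕ → MvPowerSeries (Fin d) K) :
    X i.succ * stack h = stack fun n => X i * h n := by
  ext v
  rw [X, coeff_monomial_mul, coeff_stack, coeff_stack, X, coeff_monomial_mul]
  have : Finsupp.single i 1 ≤ v.tail ↔ Finsupp.single i.succ 1 ≤ v := by
    simp [Finsupp.tail_apply]
  simp only [this]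
  split_ifs
  · congr 3
    · ext j
      simp [Finsupp.tail_apply, Finsupp.single_apply]
    · simp
  · rfl

theorem rename_succ_mul_stack (p : MvPolynomial (Fin d) K) (h : ℕ → MvPowerSeries (Fin d) K) :
    (MvPolynomial.rename Fin.succ p : MvPowerSeries (Fin (d + 1)) K) * stack h =
      stack fun n => (p : MvPowerSeries (Fin d) K) * h n := by
  induction p using MvPolynomial.induction_on generalizing h with
  | C a =>
    ext v
    simp [coeff_stack]
  | add p q hp hq =>
    rw [map_add, MvPolynomial.coe_add, add_mul, hp, hq, ← stack_add]
    simp [add_mul]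
  | mul_X p i hp =>
    rw [map_mul, MvPolynomial.rename_X, MvPolynomial.coe_mul, mul_assoc, MvPolynomial.coe_X,
      X_succ_mul_stack, hp]
    simp [mul_assoc]

theorem stack_ite_zero_one :
    stack (fun n => if n = 0 then (1 : MvPowerSeries (Fin d) K) else 0) = 1 := by
  classical
  ext v
  rw [coeff_stack, coeff_one]
  by_cases h0 : v 0 = 0
  · rw [if_pos h0, coeff_one]
    congr 1
    rw [eq_iff_iff]
    constructor
    · intro h
      ext i
      refine Fin.cases h0 (fun j => ?_) i
      simpa [Finsupp.tail_apply] using DFunLike.congr_fun h j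
    · rintro rfl
      ext
      simp [Finsupp.tail_apply]
  · rw [if_neg h0, if_neg (fun h => h0 (by simp [h])), coeff_zero]

theorem rename_succ_sub_X_zero_mul_ne_zero {p : MvPolynomial (Fin d) K} (hp : p ≠ 0)
    (q : MvPolynomial (Fin d) K) :
    MvPolynomial.rename Fin.succ p - MvPolynomial.X 0 * MvPolynomial.rename Fin.succ q ≠ 0 := by
  intro h
  -- Specializing the new variable to `0` leaves `p`.
  have := congrArg (MvPolynomial.aeval (Fin.cons 0 MvPolynomial.X :
    Fin (d + 1) → MvPolynomial (Fin d) K)) h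
  have hc : (Fin.cons 0 MvPolynomial.X : Fin (d + 1) → MvPolynomial (Fin d) K) ∘ Fin.succ =
    MvPolynomial.X := by
    ext1 i
    simp
  simp only [map_sub, map_mul, MvPolynomial.aeval_rename, hc, MvPolynomial.aeval_X, Fin.cons_zero,
    zero_mul, sub_zero, map_zero, MvPolynomial.aeval_X_left, AlgHom.id_apply] at this
  exact hp this

/-- The generating series of a geometric progression of rational power series is rational. -/
theorem IsRationalSeries.stack_geom {f g : MvPowerSeries (Fin d) K} (hf : IsRationalSeries f)
    (hg : IsRationalSeries g) : IsRationalSeries (stack fun n => f * g ^ n) := by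
  obtain ⟨P, Q, hQ, h⟩ := hf
  obtain ⟨P', Q', hQ', h'⟩ := hg
  -- With `f = P / Q` and `g = P' / Q'`, the series is `f / (1 - X 0 * g) = P Q' / (Q (Q' - X 0 *
  -- P'))`.
  refine ⟨MvPolynomial.rename Fin.succ (P * Q'), MvPolynomial.rename Fin.succ Q *
    (MvPolynomial.rename Fin.succ Q' - MvPolynomial.X 0 * MvPolynomial.rename Fin.succ P'), ?_, ?_⟩
  · refine mul_ne_zero ?_ (rename_succ_sub_X_zero_mul_ne_zero hQ' _)
    rwa [Ne, map_eq_zero_iff _ (MvPolynomial.rename_injective _ (Fin.succ_injective d))]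
  · have hsub : ∀ p q : MvPolynomial (Fin (d + 1)) K,
        ((p - q : MvPolynomial (Fin (d + 1)) K) : MvPowerSeries (Fin (d + 1)) K) = p - q :=
      fun p q => map_sub MvPolynomial.coeToMvPowerSeries.ringHom p q
    rw [MvPolynomial.coe_mul, mul_assoc, hsub, sub_mul, MvPolynomial.coe_mul, mul_assoc,
      rename_succ_mul_stack, rename_succ_mul_stack, MvPolynomial.coe_X, X_zero_mul_stack,
      ← stack_sub, rename_succ_mul_stack, ← mul_one (MvPolynomial.rename Fin.succ (P * Q') :
        MvPowerSeries (Fin (d + 1)) K), ← stack_ite_zero_one, rename_succ_mul_stack]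
    congr 1
    ext1 n
    rw [MvPolynomial.coe_mul, ← h, ← h']
    rcases n with _ | n
    · simp
      ring
    · simp
      right
      ring

/-- The power series formed by the coefficients of `R` at the exponents `(w i * v i)`. -/
def weightedSection (w : Fin d → ℕ) (R : MvPowerSeries (Fin d) K) : MvPowerSeries (Fin d) K :=
  fun v => coeff (Finsupp.equivFunOnFinite.symm fun i => w i * v i) R

theorem coeff_weightedSection (w : Fin d → ℕ) (R : MvPowerSeries (Fin d) K) (v : Fin d →₀ ℕ) :
    coeff v (weightedSection w R) = coeff (Finsupp.equivFunOnFinite.symm fun i => w i * v i) R :=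
  rfl

/-- Multiplication by `X i ^ w i` shifts exponents within the sampled sublattice, so the section
sees it as multiplication by `X i`. -/
theorem weightedSection_aeval_mul {w : Fin d → ℕ} (hw : ∀ i, w i ≠ 0) (p : MvPolynomial (Fin d) K)
    (R : MvPowerSeries (Fin d) K) :
    weightedSection w (((MvPolynomial.aeval (fun i => MvPolynomial.X i ^ w i) p :
      MvPolynomial (Fin d) K) : MvPowerSeries (Fin d) K) * R) =
      (p : MvPowerSeries (Fin d) K) * weightedSection w R := by
  induction p using MvPolynomial.induction_on generalizing R with
  | C a =>
    ext v
    simp [coeff_weightedSection, MvPolynomial.algebraMap_eq]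
  | add p q hp hq =>
    rw [map_add, MvPolynomial.coe_add, MvPolynomial.coe_add, add_mul, add_mul, ← hp, ← hq]
    ext v
    simp [coeff_weightedSection]
  | mul_X p i hp =>
    rw [map_mul, MvPolynomial.coe_mul, mul_assoc, hp, MvPolynomial.coe_mul, mul_assoc,
      MvPolynomial.aeval_X, MvPolynomial.coe_pow, MvPolynomial.coe_X]
    congr 1
    ext v
    rw [coeff_weightedSection, X_pow_eq, X, coeff_monomial_mul, coeff_monomial_mul]
    have : w i ≤ w i * v i ↔ 1 ≤ v i := by
      constructor
      · intro h
        by_contra h0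
        have : v i = 0 := by omega
        rw [this, mul_zero] at h
        exact hw i (by omega)
      · exact fun h => Nat.le_mul_of_pos_right _ h
    simp only [Finsupp.single_le_iff, Finsupp.equivFunOnFinite_symm_apply_apply, this, coeff_weightedSection]
    split_ifs
    · congr 3
      ext j
      by_cases hj : i = j
      · subst hj
        simp [mul_tsub]
      · simp [Finsupp.single_apply, hj]
    · rfl

theorem exists_coe_eq_weightedSection {w : Fin d → ℕ} (hw : ∀ i, w i ≠ 0)
    (p : MvPolynomial (Fin d) K) : ∃ q : MvPolynomial (Fin d) K,
      (q : MvPowerSeries (Fin d) K) = weightedSection w (p : MvPowerSeries (Fin d) K) := by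
  -- As every `w i` is positive, the exponent `(w i * v i)` has at least the degree of `v`, so the
  -- section has no terms beyond the total degree of `p`.
  refine ⟨truncTotal (p.totalDegree + 1) (weightedSection w (p : MvPowerSeries (Fin d) K)), ?_⟩
  ext v
  rw [MvPolynomial.coeff_coe]
  rcases lt_or_ge v.degree (p.totalDegree + 1) with hv | hv
  · rw [coeff_truncTotal _ hv]
  · rw [coeff_truncTotal_eq_zero _ hv, coeff_weightedSection, MvPolynomial.coeff_coe, eq_comm]
    apply MvPolynomial.coeff_eq_zero_of_totalDegree_lt
    refine lt_of_lt_of_le (Nat.lt_of_succ_le hv) ?_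
    rw [← Finsupp.degree_apply]
    refine Finsupp.degree_mono fun i => ?_
    simpa using Nat.le_mul_of_pos_left _ (Nat.pos_of_ne_zero (hw i))

/-- The polynomial ring is integral over the subring generated by the `X i ^ w i`, so the
denominator `Q` divides a nonzero `φ n` in that subring, say `φ n = Q * S`. Taking sections in `φ n
* R = S * P` gives `n` times the section of `R` on the left and a polynomial on the right. -/
theorem IsRationalSeries.weightedSection {w : Fin d → ℕ} (hw : ∀ i, w i ≠ 0)
    {R : MvPowerSeries (Fin d) K} (hR : IsRationalSeries R) :
    IsRationalSeries (weightedSection w R) := by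
  obtain ⟨P, Q, hQ, h⟩ := hR
  let φ : MvPolynomial (Fin d) K →ₐ[K] MvPolynomial (Fin d) K :=
    MvPolynomial.aeval fun i => MvPolynomial.X i ^ w i
  have hint : ∀ p : MvPolynomial (Fin d) K, IsIntegral φ.range p := by
    intro p
    induction p using MvPolynomial.induction_on with
    | C a => exact isIntegral_algebraMap (x := (⟨_, φ.range.algebraMap_mem a⟩ : φ.range))
    | add p q hp hq => exact hp.add hq
    | mul_X p i hp =>
      refine hp.mul (IsIntegral.of_pow (n := w i) (Nat.pos_of_ne_zero (hw i)) ?_)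
      exact isIntegral_algebraMap (x := (⟨MvPolynomial.X i ^ w i, MvPolynomial.X i,
        MvPolynomial.aeval_X _ _⟩ : φ.range))
  obtain ⟨⟨_, n, rfl⟩, hr, S, hS⟩ :=
    (hint Q).isAlgebraic.exists_nonzero_dvd (mem_nonZeroDivisors_of_ne_zero hQ)
  change φ n = Q * S at hS
  obtain ⟨T, hT⟩ := exists_coe_eq_weightedSection hw (S * P)
  refine ⟨T, n, ?_, ?_⟩
  · rintro rfl
    exact hr (Subtype.ext (map_zero φ))
  · rw [← weightedSection_aeval_mul hw, hT]
    change BinomialSum.weightedSection w ((φ n : MvPowerSeries (Fin d) K) * R) = _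
    rw [hS, MvPolynomial.coe_mul, MvPolynomial.coe_mul, ← h]
    congr 1
    ring

/-- The coefficients of a rational power series along a ray form a rational diagonal. -/
theorem IsRationalSeries.isRationalDiagonal_coeff_nsmul (hd : 1 ≤ d) {R : MvPowerSeries (Fin d) K}
    (hR : IsRationalSeries R) {w : Fin d →₀ ℕ} (hw : ∀ i, w i ≠ 0) :
    IsRationalDiagonal (PowerSeries.mk fun n => coeff (n • w) R) := by
  refine ⟨d, hd, _, hR.weightedSection hw, ?_⟩
  ext n
  simp only [diag, PowerSeries.coeff_mk, coeff_weightedSection]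
  congr 2
  ext i
  simp [mul_comm]

/-- The exponents `a + n • b` must be moved to a ray through the origin. Replacing `g` by `z^a * g`
in all but one factor turns the exponent into `n • (a + b)`, and a new variable records `n`. This
works for `n ≥ 1`; the value at `n = 0` is put in as the constant `c`. -/
theorem isRationalDiagonal_coeff_mul_pow {f g : MvPowerSeries (Fin d) K} (hf : IsRationalSeries f)
    (hg : IsRationalSeries g) (a : Fin d →₀ ℕ) {b : Fin d →₀ ℕ} (hb : ∀ i, b i ≠ 0) :
    IsRationalDiagonal (PowerSeries.mk fun n => coeff (a + n • b) (f * g ^ n)) := by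
  have ha : IsRationalSeries (monomial a (1 : K)) := by
    simpa using isRationalSeries_coe (MvPolynomial.monomial a (1 : K))
  let c : K := coeff a f
  have hD := (isRationalSeries_coe (MvPolynomial.C c)).add
    ((isRationalSeries_coe (MvPolynomial.X (0 : Fin (d + 1)))).mul
      ((hf.mul hg).stack_geom (ha.mul hg)))
  convert hD.isRationalDiagonal_coeff_nsmul (by omega) (w := Finsupp.cons 1 (a + b)) ?_ using 3 with n
  · rw [map_add, MvPolynomial.coe_X, X_zero_mul_stack, coeff_stack, MvPolynomial.coe_C, coeff_C]
    rcases n with _ | n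
    · simp [c]
    · rw [if_neg, zero_add]
      · have h1 : (n + 1) • Finsupp.cons 1 (a + b) = Finsupp.cons (n + 1) ((n + 1) • (a + b)) := by
          ext i
          refine Fin.cases ?_ (fun j => ?_) i <;> simp [mul_add]
        rw [h1, Finsupp.cons_zero, Finsupp.tail_cons, if_neg (by omega), Nat.add_sub_cancel, mul_pow,
          monomial_pow, one_pow,
          show f * g * (monomial (n • a) 1 * g ^ n) = monomial (n • a) 1 * (f * g ^ (n + 1)) by ring,
          show (n + 1) • (a + b) = n • a + (a + (n + 1) • b) by rw [smul_add, add_smul n 1 a]; abel,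
          coeff_add_monomial_mul, one_mul]
      · intro h
        have := DFunLike.congr_fun h 0
        simp at this
  · intro i
    refine Fin.cases ?_ (fun j => ?_) i
    · simp
    · simp [hb j]

/-- Multiplying by `1 / (1 - t)` with a new variable `t` does not change the diagonal. Two diagonals
can thus be added in a common number of variables. -/
theorem exists_isRationalSeries_diag_of_le {e : ℕ} (h : d ≤ e) {R : MvPowerSeries (Fin d) K}
    (hR : IsRationalSeries R) :
    ∃ S : MvPowerSeries (Fin e) K, IsRationalSeries S ∧ diag S = diag R := by
  induction e, h using Nat.le_induction with
  | base => exact ⟨R, hR, rfl⟩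
  | succ e _ ih =>
    obtain ⟨S, hS, hSR⟩ := ih
    refine ⟨_, hS.stack_geom (g := 1) (by simpa using isRationalSeries_coe 1), ?_⟩
    rw [← hSR]
    ext n
    simp only [diag, PowerSeries.coeff_mk, coeff_stack, one_pow, mul_one]
    congr 2

theorem IsRationalDiagonal.add {f g : PowerSeries K} (hf : IsRationalDiagonal f)
    (hg : IsRationalDiagonal g) : IsRationalDiagonal (f + g) := by
  obtain ⟨d, hd, R, hR, rfl⟩ := hf
  obtain ⟨e, he, S, hS, rfl⟩ := hg
  obtain ⟨R', hR', h⟩ := exists_isRationalSeries_diag_of_le (le_max_left d e) hR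
  obtain ⟨S', hS', h'⟩ := exists_isRationalSeries_diag_of_le (le_max_right d e) hS
  refine ⟨max d e, by omega, _, hR'.add hS', ?_⟩
  rw [← h, ← h']
  ext n
  simp [diag]

theorem IsRationalDiagonal.smul (c : K) {f : PowerSeries K} (hf : IsRationalDiagonal f) :
    IsRationalDiagonal (c • f) := by
  obtain ⟨d, hd, R, hR, rfl⟩ := hf
  refine ⟨d, hd, _, (isRationalSeries_coe (MvPolynomial.C c)).mul hR, ?_⟩
  ext n
  simp [diag]

end Rational

/-! ### Nonnegative bases of lexicographically ordered groups -/

section PositivelyGenerated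

/-- An ordered abelian group in which every finite set of positive elements is contained in the
cone generated by a finite `ℤ`-basis of nonnegative elements. -/
def HasPositiveBases (Γ : Type*) [AddCommGroup Γ] [LinearOrder Γ] : Prop :=
  ∀ E : Finset Γ, (∀ e ∈ E, 0 < e) → ∃ (s : ℕ) (b : Module.Basis (Fin s) ℤ Γ),
    (∀ i, 0 ≤ b i) ∧ ∀ e ∈ E, ∀ i, 0 ≤ b.repr e i

theorem hasPositiveBases_int : HasPositiveBases ℤ := fun E hE =>
  ⟨1, Module.Basis.singleton (Fin 1) ℤ, fun i => by simp, fun e he i => by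
    simpa using (hE e he).le⟩

variable {Γ₁ Γ₂ : Type*} [AddCommGroup Γ₁] [LinearOrder Γ₁] [AddCommGroup Γ₂] [LinearOrder Γ₂]

/-- The automorphism `(a, b) ↦ (a, b - l a)`, with values in the lexicographic product. -/
def lexShear (l : Γ₁ →+ Γ₂) : (Γ₁ × Γ₂) ≃ₗ[ℤ] (Γ₁ ×ₗ Γ₂) :=
  AddEquiv.toIntLinearEquiv
    { toFun := fun p => toLex (p.1, p.2 - l p.1)
      invFun := fun q => ((ofLex q).1, (ofLex q).2 + l (ofLex q).1)
      left_inv := fun p => by simp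
      right_inv := fun q => by simp
      map_add' := fun p q => by
        rw [← toLex_add]
        simp only [Prod.fst_add, Prod.snd_add, map_add, Prod.mk_add_mk]
        congr 2
        abel }

theorem exists_natCast_bound {α : Type*} {t : ℕ} (E : Finset α) (f : α → Fin t → ℤ) :
    ∃ N : ℕ, ∀ e ∈ E, ∀ j, |f e j| ≤ (N : ℤ) := by
  refine ⟨∑ e ∈ E, ∑ j, (f e j).natAbs, fun e he j => ?_⟩
  rw [Int.abs_eq_natAbs, Nat.cast_le]
  have h1 : (f e j).natAbs ≤ ∑ j, (f e j).natAbs :=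
    Finset.single_le_sum (f := fun j => (f e j).natAbs) (fun _ _ => Nat.zero_le _)
      (Finset.mem_univ j)
  exact h1.trans (Finset.single_le_sum (f := fun e => ∑ j, (f e j).natAbs)
    (fun _ _ => Nat.zero_le _) he)

theorem one_le_sum_repr {Γ : Type*} [AddCommGroup Γ] {s : ℕ} (b : Module.Basis (Fin s) ℤ Γ) {a : Γ}
    (ha : a ≠ 0) (h : ∀ i, 0 ≤ b.repr a i) : 1 ≤ ∑ i, b.repr a i := by
  by_contra! h5
  have h6 : ∑ i, b.repr a i = 0 := le_antisymm (by omega) (Finset.sum_nonneg fun i _ => h i)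
  rw [Finset.sum_eq_zero_iff_of_nonneg fun i _ => h i] at h6
  refine ha (b.repr.injective (Finsupp.ext fun i => ?_))
  simpa using h6 i (Finset.mem_univ i)

/-- Take bases `b`, `c` suited to the positive first and second components of `E`, and tilt `(b i,
0)` to `(b i, -M • ∑ j, c j)`, which stays positive in the lexicographic order. The tilt adds `M * ∑
i, b.repr a i` to each `c`-coordinate of an element with first component `a`. If `a > 0`, this is at
least `M`, which outweighs any negative coordinate; if `a = 0`, the second component is positive. -/
theorem HasPositiveBases.lex (h₁ : HasPositiveBases Γ₁) (h₂ : HasPositiveBases Γ₂) :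
    HasPositiveBases (Γ₁ ×ₗ Γ₂) := by
  classical
  intro E hE
  obtain ⟨s, b, hb, hbE⟩ := h₁ ((E.image fun e => (ofLex e).1).filter (0 < ·)) (by simp)
  obtain ⟨t, c, hc, hcE⟩ := h₂ ((E.image fun e => (ofLex e).2).filter (0 < ·)) (by simp)
  obtain ⟨N, hM'⟩ := exists_natCast_bound E fun e j => c.repr (ofLex e).2 j
  let M : ℤ := N
  have hM : 0 ≤ M := Int.natCast_nonneg N
  let wt : Γ₁ →ₗ[ℤ] ℤ := ∑ i, b.coord i
  let l : Γ₁ →ₗ[ℤ] Γ₂ := (M • wt).smulRight (∑ j, c j)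
  have hl : ∀ a j, c.repr (l a) j = M * ∑ i, b.repr a i := by
    intro a j
    simp [l, wt, Finsupp.single_apply]
  have hshear : ∀ x, lexShear l.toAddMonoidHom x = toLex (x.1, x.2 - l x.1) := fun _ => rfl
  have hshear' : ∀ x, (lexShear l.toAddMonoidHom).symm x =
    ((ofLex x).1, (ofLex x).2 + l (ofLex x).1) := fun _ => rfl
  refine ⟨s + t, ((b.prod c).map (lexShear l.toAddMonoidHom)).reindex finSumFinEquiv, ?_, ?_⟩
  · intro i
    rw [Module.Basis.reindex_apply]
    rcases finSumFinEquiv.symm i with i | j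
    · rw [Module.Basis.map_apply, hshear]
      refine le_of_lt (Prod.Lex.toLex_lt_toLex.2 (Or.inl ?_))
      rw [Module.Basis.prod_apply_inl_fst]
      exact lt_of_le_of_ne (hb i) (b.ne_zero i).symm
    · rw [Module.Basis.map_apply, hshear]
      refine Prod.Lex.toLex_le_toLex.2 (Or.inr ?_)
      rw [Module.Basis.prod_apply_inr_fst, Module.Basis.prod_apply_inr_snd]
      simpa using hc j
  · intro e he i
    have hpos := Prod.Lex.lt_iff.1 (hE e he)
    rw [Module.Basis.repr_reindex_apply, Module.Basis.map_repr, LinearEquiv.trans_apply, hshear']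
    rcases finSumFinEquiv.symm i with i | j
    · rw [Module.Basis.prod_repr_inl]
      rcases hpos with h | h
      · exact hbE _ (Finset.mem_filter.2 ⟨Finset.mem_image_of_mem _ he, h⟩) i
      · have h1 : (ofLex e).1 = 0 := h.1.symm
        simp [h1]
    · rw [Module.Basis.prod_repr_inr, map_add, Finsupp.add_apply, hl]
      rcases hpos with h | h
      · have h3 := hbE _ (Finset.mem_filter.2 ⟨Finset.mem_image_of_mem _ he, h⟩)
        have h4 := one_le_sum_repr b h.ne' h3
        have h5 := hM' e he j
        have h6 := neg_abs_le (c.repr (ofLex e).2 j)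
        have h7 := le_mul_of_one_le_right hM h4
        linarith
      · have h1 : (ofLex e).1 = 0 := h.1.symm
        have := hcE _ (Finset.mem_filter.2 ⟨Finset.mem_image_of_mem _ he, h.2⟩) j
        simpa [h1] using this

end PositivelyGenerated

/-! ### Power series as Hahn series -/

section HahnMap

variable {K σ Γ : Type*} [Field K] [Finite σ] [AddCommGroup Γ] [LinearOrder Γ]
  [IsOrderedAddMonoid Γ]

/-- The ring homomorphism from multivariate power series to Hahn series which is induced by an
injective monotone map of exponents. -/
def hahnMap (θ : (σ →₀ ℕ) →+ Γ) (hinj : Function.Injective θ) (hmono : Monotone θ) :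
    MvPowerSeries σ K →+* HahnSeries Γ K :=
  -- Dickson's lemma: the exponents are well-quasi-ordered, and monotone images inherit this.
  have hpwo : (Set.range θ).IsPWO := by
    rw [← Set.image_univ]
    exact (Set.isPWO_of_wellQuasiOrderedLE _).image_of_monotone hmono
  have hsupp : ∀ f : MvPowerSeries σ K,
      Function.support (Function.extend θ (fun v => MvPowerSeries.coeff v f) 0) ⊆ Set.range θ := by
    intro f γ hγ
    by_contra h
    exact hγ (Function.extend_apply' _ _ _ h)
  let F : MvPowerSeries σ K → HahnSeries Γ K := fun f =>
    ⟨Function.extend θ (fun v => MvPowerSeries.coeff v f) 0, hpwo.mono (hsupp f)⟩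
  have hF : ∀ f v, (F f).coeff (θ v) = MvPowerSeries.coeff v f := fun f v => hinj.extend_apply _ _ _
  have hF' : ∀ f γ, γ ∉ Set.range θ → (F f).coeff γ = 0 := fun f γ h =>
    Function.extend_apply' _ _ _ h
  { toFun := F
    map_one' := by
      classical
      ext γ
      by_cases hγ : γ ∈ Set.range θ
      · obtain ⟨v, rfl⟩ := hγ
        rw [hF, MvPowerSeries.coeff_one, HahnSeries.coeff_one]
        simp only [map_eq_zero_iff θ hinj]
      · rw [hF' _ _ hγ, HahnSeries.coeff_one, if_neg]
        rintro rfl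
        exact hγ ⟨0, map_zero θ⟩
    map_zero' := by
      ext γ
      by_cases hγ : γ ∈ Set.range θ
      · obtain ⟨v, rfl⟩ := hγ
        rw [hF]
        simp
      · rw [hF' _ _ hγ]
        simp
    map_add' := fun f g => by
      ext γ
      by_cases hγ : γ ∈ Set.range θ
      · obtain ⟨v, rfl⟩ := hγ
        rw [HahnSeries.coeff_add, hF, hF, hF, map_add]
      · rw [HahnSeries.coeff_add, hF' _ _ hγ, hF' _ _ hγ, hF' _ _ hγ, add_zero]
    map_mul' := fun f g => by
      classical
      ext γ
      have hg : (F g).support ⊆ Set.range θ := hsupp g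
      have hf : (F f).support ⊆ Set.range θ := hsupp f
      by_cases hγ : γ ∈ Set.range θ
      · obtain ⟨v, rfl⟩ := hγ
        rw [hF, HahnSeries.coeff_mul, MvPowerSeries.coeff_mul]
        -- The antidiagonal for Hahn series only contains pairs from the supports, so just the
        -- nonzero terms are matched.
        refine Finset.sum_bij_ne_zero (fun p _ _ => (θ p.1, θ p.2)) ?_ ?_ ?_ ?_
        · intro p hp h0
          rw [Finset.HasAntidiagonal.mem_antidiagonal] at hp
          rw [Finset.mem_antidiagonal]
          refine ⟨?_, ?_, by rw [← map_add, hp]⟩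
          · exact fun h => h0 (by rw [← hF f, h, zero_mul])
          · exact fun h => h0 (by rw [← hF g, h, mul_zero])
        · intro p _ _ q _ _ h
          rw [Prod.mk.injEq] at h
          exact Prod.ext (hinj h.1) (hinj h.2)
        · intro p hp h0
          rw [Finset.mem_antidiagonal] at hp
          obtain ⟨a, ha⟩ := hf hp.1
          obtain ⟨b, hb⟩ := hg hp.2.1
          refine ⟨(a, b), ?_, ?_, Prod.ext ha hb⟩
          · rw [Finset.HasAntidiagonal.mem_antidiagonal]
            exact hinj (by rw [map_add, ha, hb, hp.2.2])
          · rwa [← hF f, ← hF g, ha, hb]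
        · intro p _ _
          rw [hF, hF]
      · rw [hF' _ _ hγ, HahnSeries.coeff_mul, eq_comm]
        refine Finset.sum_eq_zero fun p hp => ?_
        exfalso
        rw [Finset.mem_antidiagonal] at hp
        obtain ⟨a, ha⟩ := hf hp.1
        obtain ⟨b, hb⟩ := hg hp.2.1
        exact hγ ⟨a + b, by rw [map_add, ha, hb, hp.2.2]⟩ }

variable (θ : (σ →₀ ℕ) →+ Γ) (hinj : Function.Injective θ) (hmono : Monotone θ)

theorem coeff_hahnMap (f : MvPowerSeries σ K) (v : σ →₀ ℕ) :
    (hahnMap θ hinj hmono f).coeff (θ v) = MvPowerSeries.coeff v f :=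
  hinj.extend_apply _ _ _

theorem coeff_hahnMap_of_notMem_range (f : MvPowerSeries σ K) {γ : Γ} (hγ : γ ∉ Set.range θ) :
    (hahnMap θ hinj hmono f).coeff γ = 0 :=
  Function.extend_apply' _ _ _ hγ

end HahnMap

/-! ### Exponents in a basis -/

section BasisExponent

variable {Γ : Type*} [AddCommGroup Γ]

/-- The map `v ↦ ∑ i, v i • b i`. -/
def basisExponent {s : ℕ} (b : Module.Basis (Fin s) ℤ Γ) : (Fin s →₀ ℕ) →+ Γ where
  toFun v := ∑ i, v i • b i
  map_zero' := by simp
  map_add' v w := by simp [add_smul, Finset.sum_add_distrib]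

theorem repr_basisExponent {s : ℕ} (b : Module.Basis (Fin s) ℤ Γ) (v : Fin s →₀ ℕ) (i : Fin s) :
    b.repr (basisExponent b v) i = v i := by
  simp [basisExponent, Finsupp.single_apply]

theorem basisExponent_injective {s : ℕ} (b : Module.Basis (Fin s) ℤ Γ) :
    Function.Injective (basisExponent b) := by
  intro v w h
  ext i
  have := repr_basisExponent b v i
  rw [h, repr_basisExponent] at this
  exact_mod_cast this.symm

theorem basisExponent_toNat_repr {s : ℕ} (b : Module.Basis (Fin s) ℤ Γ) {γ : Γ}
    (h : ∀ i, 0 ≤ b.repr γ i) :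
    basisExponent b (Finsupp.equivFunOnFinite.symm fun i => (b.repr γ i).toNat) = γ := by
  refine b.repr.injective (Finsupp.ext fun i => ?_)
  rw [repr_basisExponent]
  simp [h i]

end BasisExponent

theorem eq_sum_single {Γ K : Type*} [PartialOrder Γ] [AddCommMonoid K] {x : HahnSeries Γ K}
    (hx : x.support.Finite) : x = ∑ γ ∈ hx.toFinset, HahnSeries.single γ (x.coeff γ) := by
  ext γ
  rw [HahnSeries.coeff_sum, Finset.sum_eq_single γ]
  · rw [HahnSeries.coeff_single_same]
  · exact fun e _ he => HahnSeries.coeff_single_of_ne he.symm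
  · intro h
    rw [HahnSeries.coeff_single_same]
    simpa using h

/-! ### Rational functions as Hahn series, and their constant terms -/

section RationalHahn

open HahnSeries

variable {Γ K : Type*} [AddCommGroup Γ] [LinearOrder Γ] [IsOrderedAddMonoid Γ] [Field K]

theorem hahnMap_monomial {σ : Type*} [Finite σ] (θ : (σ →₀ ℕ) →+ Γ) (hinj : Function.Injective θ)
    (hmono : Monotone θ) (v : σ →₀ ℕ) (c : K) :
    hahnMap θ hinj hmono (MvPowerSeries.monomial v c) = single (θ v) c := by
  classical
  ext γ
  by_cases hγ : γ ∈ Set.range θ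
  · obtain ⟨w, rfl⟩ := hγ
    rw [coeff_hahnMap, MvPowerSeries.coeff_monomial, coeff_single]
    simp only [hinj.eq_iff]
  · rw [coeff_hahnMap_of_notMem_range _ _ _ _ hγ, coeff_single_of_ne]
    rintro rfl
    exact hγ ⟨v, rfl⟩

theorem basisExponent_monotone {s : ℕ} {b : Module.Basis (Fin s) ℤ Γ} (hb : ∀ i, 0 ≤ b i) :
    Monotone (basisExponent b) := by
  intro v w h
  change ∑ i, v i • b i ≤ ∑ i, w i • b i
  exact Finset.sum_le_sum fun i _ => nsmul_le_nsmul_left (hb i) (h i)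

/-- The map from power series to Hahn series attached to a basis of nonnegative elements. -/
def basisHahnMap (K : Type*) [Field K] {s : ℕ} (b : Module.Basis (Fin s) ℤ Γ) (hb : ∀ i, 0 ≤ b i) :
    MvPowerSeries (Fin s) K →+* HahnSeries Γ K :=
  hahnMap (basisExponent b) (basisExponent_injective b) (basisExponent_monotone hb)

theorem coeff_basisHahnMap {s : ℕ} (b : Module.Basis (Fin s) ℤ Γ) (hb : ∀ i, 0 ≤ b i)
    (f : MvPowerSeries (Fin s) K) (v : Fin s →₀ ℕ) :
    (basisHahnMap K b hb f).coeff (basisExponent b v) = MvPowerSeries.coeff v f :=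
  coeff_hahnMap _ _ _ _ _

theorem exists_basisHahnMap_eq {s : ℕ} (b : Module.Basis (Fin s) ℤ Γ) (hb : ∀ i, 0 ≤ b i)
    {x : HahnSeries Γ K} (hx : x.support.Finite) (h : ∀ γ ∈ x.support, ∀ i, 0 ≤ b.repr γ i) :
    ∃ P : MvPolynomial (Fin s) K, basisHahnMap K b hb P = x := by
  refine ⟨∑ γ ∈ hx.toFinset, MvPolynomial.monomial
    (Finsupp.equivFunOnFinite.symm fun i => (b.repr γ i).toNat) (x.coeff γ), ?_⟩
  conv_rhs => rw [eq_sum_single hx]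
  rw [← MvPolynomial.coeToMvPowerSeries.ringHom_apply, map_sum, map_sum]
  refine Finset.sum_congr rfl fun γ hγ => ?_
  rw [MvPolynomial.coeToMvPowerSeries.ringHom_apply, MvPolynomial.coe_monomial, basisHahnMap,
    hahnMap_monomial, basisExponent_toNat_repr b (h γ (by simpa using hγ))]

/-- The field of rational functions, inside the field of Hahn series. -/
def rationalHahn (Γ K : Type*) [AddCommGroup Γ] [LinearOrder Γ] [IsOrderedAddMonoid Γ] [Field K] :
    Subfield (HahnSeries Γ K) :=
  Subfield.closure {x | ∃ γ c, x = single γ c}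

theorem single_mem_rationalHahn (γ : Γ) (c : K) : single γ c ∈ rationalHahn Γ K :=
  Subfield.subset_closure ⟨γ, c, rfl⟩

theorem finite_support_of_mem_closure {x : HahnSeries Γ K}
    (hx : x ∈ Subring.closure {x : HahnSeries Γ K | ∃ γ c, x = single γ c}) :
    x.support.Finite := by
  induction hx using Subring.closure_induction with
  | mem x h =>
    obtain ⟨γ, c, rfl⟩ := h
    exact (Set.finite_singleton γ).subset support_single_subset
  | zero => simp
  | one => exact (Set.finite_singleton 0).subset support_single_subset
  | add x y _ _ hx hy => exact (hx.union hy).subset (support_add_subset x y)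
  | neg x _ hx => rwa [support_neg]
  | mul x y _ _ hx hy => exact (hx.add hy).subset support_mul_subset

theorem finite_support_single_mul (γ : Γ) (c : K) {x : HahnSeries Γ K} (hx : x.support.Finite) :
    (single γ c * x).support.Finite :=
  (((Set.finite_singleton γ).subset support_single_subset).add hx).subset support_mul_subset

/-- Write `x = y / q` with finite supports and divide both by the leading monomial of `q`. If the
positive exponents `E` of the new denominator have nonnegative coordinates, it becomes a polynomial
with nonzero constant term, invertible as a power series. A monomial `a` clears the negative
coordinates of the numerator. As `E` precedes the basis, one basis can serve several `x`. -/
theorem exists_rationalSeries_of_mem_rationalHahn {x : HahnSeries Γ K} (hx : x ∈ rationalHahn Γ K) :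
    ∃ E : Finset Γ, (∀ e ∈ E, 0 < e) ∧ ∀ (s : ℕ) (b : Module.Basis (Fin s) ℤ Γ)
      (hb : ∀ i, 0 ≤ b i), (∀ e ∈ E, ∀ i, 0 ≤ b.repr e i) →
      ∃ (a : Fin s →₀ ℕ) (f : MvPowerSeries (Fin s) K), (∀ i, a i ≠ 0) ∧ IsRationalSeries f ∧
        single (basisExponent b a) 1 * x = basisHahnMap K b hb f := by
  classical
  obtain ⟨y, hy, q, hq, rfl⟩ := Subfield.mem_closure_iff.1 hx
  replace hy := finite_support_of_mem_closure hy
  replace hq := finite_support_of_mem_closure hq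
  -- Here `y / 0 = 0`, so `q = 0` is the case `x = 0`.
  rcases eq_or_ne q 0 with rfl | hq0
  · refine ⟨∅, by simp, fun s b hb _ => ⟨Finsupp.equivFunOnFinite.symm fun _ => 1, 0, by simp,
      by simpa using isRationalSeries_coe 0, by simp⟩⟩
  let m : HahnSeries Γ K := single (-q.order) 1
  have hm : m ≠ 0 := by simp [m]
  have hqs : (m * q).support.Finite := finite_support_single_mul _ _ hq
  have hys : (m * y).support.Finite := finite_support_single_mul _ _ hy
  have hq1 : (m * q).coeff 0 ≠ 0 := by
    simpa [m, coeff_single_mul] using hq0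
  have hq2 : ∀ γ ∈ (m * q).support, 0 ≤ γ := by
    intro γ hγ
    have h1 : (m * q).coeff γ ≠ 0 := hγ
    rw [coeff_single_mul, one_mul, sub_neg_eq_add] at h1
    simpa using order_le_of_coeff_ne_zero h1
  refine ⟨hqs.toFinset.filter (0 < ·), by simp, fun s b hb hE => ?_⟩
  obtain ⟨Q, hQ⟩ := exists_basisHahnMap_eq b hb hqs fun γ hγ i => by
    rcases (hq2 γ hγ).eq_or_lt with rfl | h
    · simp
    · exact hE γ (Finset.mem_filter.2 ⟨hqs.mem_toFinset.2 hγ, h⟩) i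
  have hQ0 : MvPowerSeries.constantCoeff (Q : MvPowerSeries (Fin s) K) ≠ 0 := by
    rw [← MvPowerSeries.coeff_zero_eq_constantCoeff_apply, ← coeff_basisHahnMap b hb, hQ, map_zero]
    exact hq1
  obtain ⟨N, hN⟩ := exists_natCast_bound hys.toFinset fun γ i => b.repr γ i
  -- `N` would clear the numerator; the extra `1` makes every entry nonzero.
  let a : Fin s →₀ ℕ := Finsupp.equivFunOnFinite.symm fun _ => N + 1
  obtain ⟨P, hP⟩ := exists_basisHahnMap_eq b hb
    (finite_support_single_mul (basisExponent b a) 1 hys) fun γ hγ i => by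
      have h1 : (single (basisExponent b a) 1 * (m * y)).coeff γ ≠ 0 := hγ
      rw [coeff_single_mul, one_mul] at h1
      have h2 := hN _ (hys.mem_toFinset.2 h1) i
      rw [map_sub, Finsupp.sub_apply, repr_basisExponent] at h2
      have := (abs_le.1 h2).1
      simp [a] at this
      linarith
  refine ⟨a, (P : MvPowerSeries (Fin s) K) * (Q : MvPowerSeries (Fin s) K)⁻¹, by simp [a],
    ⟨P, Q, ?_, ?_⟩, ?_⟩
  · rintro rfl
    simp at hQ0
  · rw [mul_left_comm, MvPowerSeries.mul_inv_cancel _ hQ0, mul_one]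
  · have h1 : basisHahnMap K b hb (P * (Q : MvPowerSeries (Fin s) K)⁻¹) * (m * q) =
        single (basisExponent b a) 1 * (m * y) := by
      rw [← hQ, ← map_mul, mul_assoc, MvPowerSeries.inv_mul_cancel _ hQ0, mul_one, hP]
    rw [← mul_div_assoc, div_eq_iff hq0]
    apply mul_left_cancel₀ hm
    rw [mul_left_comm, ← h1]
    ring

/-- The constant terms of a geometric progression of rational functions have a generating function
that is a rational diagonal. -/
theorem isRationalDiagonal_coeff_zero_mul_pow (hΓ : HasPositiveBases Γ) {x y : HahnSeries Γ K}
    (hx : x ∈ rationalHahn Γ K) (hy : y ∈ rationalHahn Γ K) :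
    IsRationalDiagonal (PowerSeries.mk fun n => (x * y ^ n).coeff 0) := by
  classical
  obtain ⟨E, hE, hxE⟩ := exists_rationalSeries_of_mem_rationalHahn hx
  obtain ⟨F, hF, hyF⟩ := exists_rationalSeries_of_mem_rationalHahn hy
  obtain ⟨s, b, hb, hbEF⟩ := hΓ (E ∪ F) fun e he => (Finset.mem_union.1 he).elim (hE e) (hF e)
  obtain ⟨u, f, -, hf, hxf⟩ := hxE s b hb fun e he => hbEF e (Finset.mem_union_left _ he)
  obtain ⟨v, g, hv, hg, hyg⟩ := hyF s b hb fun e he => hbEF e (Finset.mem_union_right _ he)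
  -- Multiplying `x` and `y` by the monomials of exponents `u` and `v` moves the constant term of `x
  -- * y ^ n` to exponent `u + n • v`.
  convert isRationalDiagonal_coeff_mul_pow hf hg u hv using 3 with n
  rw [← coeff_basisHahnMap b hb, map_mul, map_pow, ← hxf, ← hyg, mul_pow, single_pow, one_pow,
    mul_mul_mul_comm, single_mul_single, coeff_single_mul, map_add, map_nsmul]
  simp

end RationalHahn

/-! ### Linearity and telescoping of directed sums -/

section DirectedSum

theorem directedSum_add {M : Type*} [AddCommGroup M] (a b : ℤ) (u v : ℤ → M) :
    directedSum a b (fun k => u k + v k) = directedSum a b u + directedSum a b v := by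
  simp only [directedSum]
  split_ifs
  · exact Finset.sum_add_distrib
  · rw [Finset.sum_add_distrib, neg_add]

theorem directedSum_smul {R M : Type*} [Ring R] [AddCommGroup M] [Module R M] (c : R) (a b : ℤ)
    (u : ℤ → M) : directedSum a b (fun k => c • u k) = c • directedSum a b u := by
  simp only [directedSum]
  split_ifs <;> simp [Finset.smul_sum]

theorem directedSum_zero {M : Type*} [AddCommGroup M] (a b : ℤ) :
    directedSum a b (fun _ => (0 : M)) = 0 := by
  simp [directedSum]

/-- The sign convention for directed sums makes telescoping uniform in `m`; this is what makes
geometric sums one formula for all integers. -/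
theorem directedSum_sub {M : Type*} [AddCommGroup M] (F : ℤ → M) (m : ℤ) :
    directedSum 0 m (fun k => F (k + 1) - F k) = F (m + 1) - F 0 := by
  rcases le_or_gt 0 m with hm | hm
  · lift m to ℕ using hm
    rw [directedSum_of_nonneg]
    simpa using Finset.sum_range_sub (fun k : ℕ => F k) (m + 1)
  · obtain ⟨j, rfl⟩ : ∃ j : ℕ, m = -(j : ℤ) - 1 := ⟨(-m - 1).toNat, by omega⟩
    rw [directedSum_of_neg hm]
    have : ∑ k ∈ Finset.Icc (-(j : ℤ) - 1 + 1) (-1), (F (k + 1) - F k) =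
        ∑ i ∈ Finset.range j, (F (-(i : ℤ)) - F (-((i + 1 : ℕ) : ℤ))) := by
      symm
      refine Finset.sum_bij (fun i _ => -((i : ℤ) + 1)) ?_ ?_ ?_ ?_
      · intro i hi
        simp at hi ⊢
        omega
      · intro i _ k _ h
        omega
      · intro k hk
        simp at hk
        exact ⟨(-k - 1).toNat, by simp; omega, by omega⟩
      · intro i _
        congr 2
        · ring
    rw [this, Finset.sum_range_sub' (fun i : ℕ => F (-(i : ℤ)))]
    simp

theorem directedSum_const {R : Type*} [Ring R] (c : R) (m : ℤ) :
    directedSum 0 m (fun _ => c) = (m + 1) * c := by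
  have := directedSum_sub (fun k : ℤ => (k : R) * c) m
  simpa [add_mul] using this

end DirectedSum

/-! ### Binomial sums are linear combinations of constant terms -/

section ConstantTerms

open HahnSeries

variable {K : Type*} [Field K]

/-- The sequences `n ↦ [1] (S * R₁ ^ n₁ * ⋯ * R_d ^ n_d)`, where `S` and the `Rᵢ` are rational
functions in a field of Hahn series, and `[1]` is the constant term. -/
def constantTermSeqs (K : Type*) [Field K] : Set ((ℕ → ℤ) → K) :=
  {f | ∃ (Γ : Type) (_ : AddCommGroup Γ) (_ : LinearOrder Γ) (_ : IsOrderedAddMonoid Γ),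
    HasPositiveBases Γ ∧ ∃ S ∈ rationalHahn Γ K, ∃ χ : AddChar (ℕ → ℤ) (HahnSeries Γ K),
      (∀ n, χ n ∈ rationalHahn Γ K) ∧ (∃ d : ℕ, ∀ n, (∀ i < d, n i = 0) → χ n = 1) ∧
      f = fun n => (S * χ n).coeff 0}

theorem one_mem_constantTermSeqs : 1 ∈ constantTermSeqs K :=
  ⟨ℤ, _, _, inferInstance, hasPositiveBases_int, 1, one_mem _, 1, fun _ => one_mem _,
    ⟨0, fun _ _ => rfl⟩, by ext n; simp⟩

section Lex

variable {Γ₁ Γ₂ : Type*} [AddCommGroup Γ₁] [LinearOrder Γ₁] [IsOrderedAddMonoid Γ₁]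
  [AddCommGroup Γ₂] [LinearOrder Γ₂] [IsOrderedAddMonoid Γ₂]

/-- The inclusion of Hahn series along the first factor of a lexicographic product. -/
def lexInl (K Γ₁ Γ₂ : Type*) [Field K] [AddCommGroup Γ₁] [LinearOrder Γ₁] [IsOrderedAddMonoid Γ₁]
    [AddCommGroup Γ₂] [LinearOrder Γ₂] [IsOrderedAddMonoid Γ₂] :
    HahnSeries Γ₁ K →+* HahnSeries (Γ₁ ×ₗ Γ₂) K :=
  embDomainRingHom (AddMonoidHom.mk' (fun a => toLex (a, (0 : Γ₂))) fun a b => by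
      rw [← toLex_add]; simp)
    (fun a b h => by simpa using h) (fun a b =>
      Prod.Lex.toLex_le_toLex.trans (by simp [le_iff_lt_or_eq]))

/-- The inclusion of Hahn series along the second factor of a lexicographic product. -/
def lexInr (K Γ₁ Γ₂ : Type*) [Field K] [AddCommGroup Γ₁] [LinearOrder Γ₁] [IsOrderedAddMonoid Γ₁]
    [AddCommGroup Γ₂] [LinearOrder Γ₂] [IsOrderedAddMonoid Γ₂] :
    HahnSeries Γ₂ K →+* HahnSeries (Γ₁ ×ₗ Γ₂) K :=
  embDomainRingHom (AddMonoidHom.mk' (fun b => toLex ((0 : Γ₁), b)) fun a b => by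
      rw [← toLex_add]; simp)
    (fun a b h => by simpa using h) (fun a b => by
      simp [Prod.Lex.toLex_le_toLex])

theorem map_mem_rationalHahn {Γ Γ' : Type*} [AddCommGroup Γ] [LinearOrder Γ] [IsOrderedAddMonoid Γ]
    [AddCommGroup Γ'] [LinearOrder Γ'] [IsOrderedAddMonoid Γ'] {f : Γ →+ Γ'}
    (hfi : Function.Injective f) (hf : ∀ g g', f g ≤ f g' ↔ g ≤ g') {x : HahnSeries Γ K}
    (hx : x ∈ rationalHahn Γ K) : embDomainRingHom f hfi hf x ∈ rationalHahn Γ' K := by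
  have : rationalHahn Γ K ≤ (rationalHahn Γ' K).comap (embDomainRingHom f hfi hf) := by
    refine Subfield.closure_le.2 ?_
    rintro _ ⟨γ, c, rfl⟩
    rw [SetLike.mem_coe, Subfield.mem_comap, embDomainRingHom_apply, embDomain_single]
    exact single_mem_rationalHahn _ _
  exact this hx

/-- The two factors have independent exponents: `(a, 0) + (0, b) = 0` forces `a = 0` and `b = 0`. -/
theorem coeff_zero_lexInl_mul_lexInr (x : HahnSeries Γ₁ K) (y : HahnSeries Γ₂ K) :
    (lexInl K Γ₁ Γ₂ x * lexInr K Γ₁ Γ₂ y).coeff 0 = x.coeff 0 * y.coeff 0 := by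
  have h1 : (lexInl K Γ₁ Γ₂ x).coeff 0 = x.coeff 0 := embDomain_coeff (a := (0 : Γ₁))
  have h2 : (lexInr K Γ₁ Γ₂ y).coeff 0 = y.coeff 0 := embDomain_coeff (a := (0 : Γ₂))
  rw [coeff_mul, ← h1, ← h2]
  refine Finset.sum_eq_single (0, 0) ?_ ?_
  · rintro ⟨u, v⟩ h hne
    exfalso
    rw [Finset.mem_antidiagonal] at h
    obtain ⟨a, -, ha⟩ := support_embDomain_subset h.1
    obtain ⟨b, -, hb⟩ := support_embDomain_subset h.2.1
    have ha : toLex (a, (0 : Γ₂)) = u := ha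
    have hb : toLex ((0 : Γ₁), b) = v := hb
    have h3 := h.2.2
    simp only [← ha, ← hb, ← toLex_add] at h3
    have h4 : ((a, (0 : Γ₂)) + ((0 : Γ₁), b)) = 0 := h3
    simp at h4
    apply hne
    rw [← ha, ← hb, h4.1, h4.2]
    rfl
  · intro h
    rw [Finset.mem_antidiagonal] at h
    by_contra h0
    exact h ⟨left_ne_zero_of_mul h0, right_ne_zero_of_mul h0, add_zero 0⟩

end Lex

theorem mul_mem_constantTermSeqs {f g : (ℕ → ℤ) → K} (hf : f ∈ constantTermSeqs K)
    (hg : g ∈ constantTermSeqs K) : f * g ∈ constantTermSeqs K := by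
  obtain ⟨Γ, _, _, _, hΓ, S, hS, χ, hχ, ⟨d, hd⟩, rfl⟩ := hf
  obtain ⟨Γ', _, _, _, hΓ', S', hS', χ', hχ', ⟨d', hd'⟩, rfl⟩ := hg
  refine ⟨Γ ×ₗ Γ', _, _, inferInstance, hΓ.lex hΓ', lexInl K Γ Γ' S * lexInr K Γ Γ' S',
    mul_mem (map_mem_rationalHahn _ _ hS) (map_mem_rationalHahn _ _ hS'),
    (lexInl K Γ Γ' : _ →* _).compAddChar χ * (lexInr K Γ Γ' : _ →* _).compAddChar χ',
    fun n => mul_mem (map_mem_rationalHahn _ _ (hχ n)) (map_mem_rationalHahn _ _ (hχ' n)),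
    ⟨max d d', fun n hn => ?_⟩, ?_⟩
  · simp [hd n fun i hi => hn i (by omega), hd' n fun i hi => hn i (by omega)]
  · ext n
    simp only [Pi.mul_apply, AddChar.mul_apply, MonoidHom.compAddChar_apply, Function.comp_apply,
      MonoidHom.coe_coe]
    rw [mul_mul_mul_comm, ← map_mul, ← map_mul, coeff_zero_lexInl_mul_lexInr]

/-- The algebra spanned by the sequences of constant terms. -/
def constantTermSums (K : Type*) [Field K] : Subalgebra K ((ℕ → ℤ) → K) :=
  (Submodule.span K (constantTermSeqs K)).toSubalgebra
    (Submodule.subset_span one_mem_constantTermSeqs) fun x y hx hy => by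
      have := Submodule.mul_mem_mul hx hy
      rw [Submodule.span_mul_span] at this
      refine Submodule.span_mono ?_ this
      rintro _ ⟨f, hf, g, hg, rfl⟩
      exact mul_mem_constantTermSeqs hf hg

theorem mem_constantTermSums {f : (ℕ → ℤ) → K} :
    f ∈ constantTermSums K ↔ f ∈ Submodule.span K (constantTermSeqs K) :=
  Iff.rfl

theorem constantTerm_comp_mem {Γ : Type} [AddCommGroup Γ] [LinearOrder Γ] [IsOrderedAddMonoid Γ]
    (hΓ : HasPositiveBases Γ) {S : HahnSeries Γ K} (hS : S ∈ rationalHahn Γ K)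
    {χ : AddChar (ℕ → ℤ) (HahnSeries Γ K)} (hχ : ∀ n, χ n ∈ rationalHahn Γ K)
    (α : (ℕ → ℤ) →+ (ℕ → ℤ)) {d : ℕ} (hα : ∀ n, (∀ i < d, n i = 0) → α n = 0) :
    (fun n => (S * χ (α n)).coeff 0) ∈ constantTermSums K :=
  Submodule.subset_span ⟨Γ, _, _, inferInstance, hΓ, S, hS, χ.compAddMonoidHom α, fun n => hχ _,
    ⟨d, fun n hn => by simp [hα n hn]⟩, rfl⟩

theorem constantTermSums_le_seqAlgebra : constantTermSums K ≤ seqAlgebra K := by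
  intro f hf
  rw [mem_constantTermSums] at hf
  refine (Submodule.span_le (p := Subalgebra.toSubmodule (seqAlgebra K))).2 ?_ hf
  rintro _ ⟨Γ, _, _, _, hΓ, S, hS, χ, hχ, ⟨d, hd⟩, rfl⟩
  refine ⟨d, fun n => (S * χ (pad n)).coeff 0, ?_⟩
  ext n
  have h : χ n = χ (pad fun i : Fin d => n i) := by
    rw [← sub_add_cancel n (pad fun i : Fin d => n i), AddChar.map_add_eq_mul,
      hd (n - _) fun i hi => by simp [pad, hi], one_mul]
    simp
  simp only [extend, h]

/-- `pad` as an additive map. -/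
def padHom (d : ℕ) : (Fin d → ℤ) →+ (ℕ → ℤ) :=
  AddMonoidHom.mk' pad fun m n => by
    ext i
    simp only [pad, Pi.add_apply]
    split_ifs <;> simp

theorem affine_mem_constantTermSums {d e : ℕ} (φ : (Fin d → ℤ) →ᵃ[ℤ] (Fin e → ℤ))
    {u : (ℕ → ℤ) → K} (hu : u ∈ constantTermSums K) :
    extend (fun n : Fin d → ℤ => u (pad (φ n))) ∈ constantTermSums K := by
  let A : ((ℕ → ℤ) → K) →ₗ[K] ((ℕ → ℤ) → K) :=
    LinearMap.funLeft K K fun n : ℕ → ℤ => pad (φ fun i : Fin d => n i)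
  refine (Submodule.span_le (p := (Subalgebra.toSubmodule (constantTermSums K)).comap A)).2 ?_
    (mem_constantTermSums.1 hu)
  rintro _ ⟨Γ, _, _, _, hΓ, S, hS, χ, hχ, -, rfl⟩
  let α : (ℕ → ℤ) →+ (ℕ → ℤ) := (padHom e).comp (φ.linear.toAddMonoidHom.comp
    (AddMonoidHom.mk' (fun (n : ℕ → ℤ) (i : Fin d) => n i) fun _ _ => rfl))
  have hα : ∀ n, (∀ i < d, n i = 0) → α n = 0 := by
    intro n hn
    have : (fun i : Fin d => n i) = 0 := funext fun i => hn i i.2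
    simp [α, this]
  rw [SetLike.mem_coe, Submodule.mem_comap]
  -- The translation part of `φ` contributes a fixed rational factor, absorbed into `S`; the linear
  -- part is composed with the character.
  convert constantTerm_comp_mem hΓ (mul_mem hS (hχ (padHom e (φ 0)))) hχ α hα using 1
  rw [Subalgebra.mem_toSubmodule, iff_iff_eq]
  congr 1
  ext n
  have h1 : φ (fun i : Fin d => n i) = φ.linear (fun i : Fin d => n i) + φ 0 := by
    have := φ.map_vadd 0 (fun i : Fin d => n i)
    simpa using this
  change (S * χ (padHom e (φ fun i : Fin d => n i))).coeff 0 = _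
  rw [h1, map_add, AddChar.map_add_eq_mul, mul_comm (χ _), mul_assoc]
  rfl

/-- This is the constant term of `z ^ n`. -/
theorem delta_mem_constantTermSums :
    extend (fun n : Fin 1 → ℤ => if n 0 = 0 then (1 : K) else 0) ∈ constantTermSums K := by
  refine Submodule.subset_span ⟨ℤ, _, _, inferInstance, hasPositiveBases_int, 1, one_mem _,
    { toFun := fun n => single (n 0) 1
      map_zero_eq_one' := rfl
      map_add_eq_mul' := fun m n => by simp }, fun n => single_mem_rationalHahn _ _,
    ⟨1, fun n hn => ?_⟩, ?_⟩
  · simp [hn 0 (by omega)]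
  · ext n
    simp [extend, coeff_single, eq_comm]

theorem geom_mem_constantTermSums {C : K} (hC : C ≠ 0) :
    extend (fun n : Fin 1 → ℤ => C ^ n 0) ∈ constantTermSums K := by
  refine Submodule.subset_span ⟨ℤ, _, _, inferInstance, hasPositiveBases_int, 1, one_mem _,
    { toFun := fun n => single 0 (C ^ n 0)
      map_zero_eq_one' := by simp
      map_add_eq_mul' := fun m n => by simp [zpow_add₀ hC] }, fun n => single_mem_rationalHahn _ _,
    ⟨1, fun n hn => ?_⟩, ?_⟩
  · simp [hn 0 (by omega)]
  · ext n
    simp [extend]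

/-- The character `n ↦ (1 + z) ^ n`. -/
def binomialChar (K : Type*) [Field K] : AddChar ℤ (HahnSeries ℤ K) where
  toFun n := ofPowerSeries ℤ K (PowerSeries.binomialSeries K n)
  map_zero_eq_one' := by simp
  map_add_eq_mul' m n := by simp

theorem binomialChar_mem (n : ℤ) : binomialChar K n ∈ rationalHahn ℤ K := by
  have h1 : binomialChar K 1 ∈ rationalHahn ℤ K := by
    have : binomialChar K 1 = 1 + single 1 1 := by
      have := PowerSeries.binomialSeries_nat (R := ℤ) (A := K) 1
      simp only [Nat.cast_one, pow_one] at this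
      change ofPowerSeries ℤ K (PowerSeries.binomialSeries K (1 : ℤ)) = _
      rw [this]
      simp
    rw [this]
    exact add_mem (one_mem _) (single_mem_rationalHahn _ _)
  have := (binomialChar K).map_zsmul_eq_zpow n 1
  rw [smul_eq_mul, mul_one] at this
  rw [this]
  exact zpow_mem h1 n

theorem coeff_binomialChar (n k : ℤ) : (binomialChar K n).coeff k = intChoose n k := by
  change (ofPowerSeries ℤ K (PowerSeries.binomialSeries K n)).coeff k = _
  rw [intChoose]
  split_ifs with hk
  · lift k to ℕ using hk
    rw [ofPowerSeries_apply_coeff]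
    simp
  · rw [ofPowerSeries_apply, embDomain_of_notMem_range]
    · simp
    · rintro ⟨m, rfl⟩
      simp at hk

/-- This is the constant term of `(1 + z) ^ n * z ^ (-k)`, for `n` and `k` of any sign. -/
theorem choose_mem_constantTermSums :
    extend (fun n : Fin 2 → ℤ => (intChoose (n 0) (n 1) : K)) ∈ constantTermSums K := by
  refine Submodule.subset_span ⟨ℤ, _, _, inferInstance, hasPositiveBases_int, 1, one_mem _,
    { toFun := fun n => binomialChar K (n 0) * single (-n 1) 1
      map_zero_eq_one' := by simp
      map_add_eq_mul' := fun m n => by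
        rw [Pi.add_apply, Pi.add_apply, AddChar.map_add_eq_mul, mul_mul_mul_comm,
          single_mul_single, mul_one, neg_add] },
    fun n => mul_mem (binomialChar_mem _) (single_mem_rationalHahn _ _),
    ⟨2, fun n hn => ?_⟩, ?_⟩
  · simp [hn 0 (by omega), hn 1 (by omega)]
  · ext n
    simp [extend, coeff_mul_single, coeff_binomialChar]

/-- It is `choose (n d) 1`. It is needed for summing a geometric progression of ratio `1`. -/
theorem coordinate_mem_constantTermSums (d : ℕ) :
    (fun n : ℕ → ℤ => (n d : K)) ∈ constantTermSums K := by
  have h := affine_mem_constantTermSums (d := d + 1) (AffineMap.pi ![(LinearMap.proj (R := ℤ)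
    (φ := fun _ : Fin (d + 1) => ℤ) (Fin.last d)).toAffineMap, AffineMap.const ℤ _ 1])
    (choose_mem_constantTermSums (K := K))
  simp only [extend_pad] at h
  convert h using 1
  ext n
  simp [extend, intChoose]

/-- The map replacing all entries from the `d`-th on by `0`. -/
def truncHom (d : ℕ) : (ℕ → ℤ) →+ (ℕ → ℤ) :=
  AddMonoidHom.mk' (fun n i => if i < d then n i else 0) fun m n => by
    ext i
    simp only [Pi.add_apply]
    split_ifs <;> simp

theorem truncHom_eq_zero (d : ℕ) (n : ℕ → ℤ) (hn : ∀ i < d, n i = 0) : truncHom d n = 0 := by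
  ext i
  simp only [truncHom, AddMonoidHom.mk'_apply, Pi.zero_apply]
  split_ifs with h
  · exact hn i h
  · rfl

theorem pad_snoc_init (d : ℕ) (n : ℕ → ℤ) (k : ℤ) :
    pad (Fin.snoc (α := fun _ => ℤ) (Fin.init fun i : Fin (d + 1) => n i) k : Fin (d + 1) → ℤ) =
      truncHom d n + k • Pi.single d 1 := by
  ext i
  simp only [pad, truncHom, AddMonoidHom.mk'_apply, Pi.add_apply, Pi.smul_apply, Pi.single_apply]
  rcases lt_trichotomy i d with h | rfl | h
  · rw [dif_pos (by omega), if_pos h, if_neg h.ne]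
    simp [Fin.snoc, h, Fin.init]
  · simp [Fin.snoc]
  · rw [dif_neg (by omega), if_neg (by omega), if_neg (by omega)]
    simp

theorem truncHom_succ (d : ℕ) (n : ℕ → ℤ) :
    truncHom (d + 1) n = truncHom d n + n d • Pi.single d 1 := by
  ext i
  simp only [truncHom, AddMonoidHom.mk'_apply, Pi.add_apply, Pi.smul_apply, Pi.single_apply]
  rcases lt_trichotomy i d with h | rfl | h
  · rw [if_pos (by omega), if_pos h, if_neg h.ne]
    simp
  · simp
  · rw [if_neg (by omega), if_neg (by omega), if_neg (by omega)]
    simp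

/-- By linearity the summand is `[1] (S * χ * ρ ^ k)`, where `ρ` is the value of the character at
the unit vector of the summation index. If `ρ ≠ 1`, the geometric sum is `(ρ ^ (m + 1) - 1) / (ρ -
1)`, a difference of two constant terms, since `ρ - 1` is invertible among rational functions. If `ρ
= 1`, the sum is `m + 1` times a constant term. -/
theorem sum_mem_constantTermSums (d : ℕ) {u : (ℕ → ℤ) → K} (hu : u ∈ constantTermSums K) :
    extend (fun n : Fin (d + 1) → ℤ => directedSum 0 (n (Fin.last d)) fun k : ℤ =>
      u (pad (Fin.snoc (α := fun _ => ℤ) (Fin.init n) k : Fin (d + 1) → ℤ))) ∈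
      constantTermSums K := by
  have hext : ∀ u : (ℕ → ℤ) → K, extend (fun n : Fin (d + 1) → ℤ =>
      directedSum 0 (n (Fin.last d)) fun k : ℤ =>
        u (pad (Fin.snoc (α := fun _ => ℤ) (Fin.init n) k : Fin (d + 1) → ℤ))) =
      fun n => directedSum 0 (n d) fun k => u (truncHom d n + k • Pi.single d 1) := by
    intro u
    ext n
    simp only [extend, pad_snoc_init, Fin.val_last]
  rw [hext]
  refine Submodule.span_induction
    (p := fun u _ => (fun n => directedSum 0 (n d) fun k =>
      u (truncHom d n + k • Pi.single d 1)) ∈ constantTermSums K) ?_ ?_ ?_ ?_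
    (mem_constantTermSums.1 hu)
  · rintro _ ⟨Γ, _, _, _, hΓ, S, hS, χ, hχ, -, rfl⟩
    let ρ := χ (Pi.single d 1)
    have h1 : ∀ (n : ℕ → ℤ) (k : ℤ), χ (truncHom d n + k • Pi.single d 1) = χ (truncHom d n) * ρ ^ k := by
      intro n k
      rw [AddChar.map_add_eq_mul, AddChar.map_zsmul_eq_zpow]
    simp only [h1]
    have hρ0 : ρ ≠ 0 := (χ.val_isUnit _).ne_zero
    by_cases hρ : ρ = 1
    · simp only [hρ, one_zpow, mul_one, directedSum_const]
      exact mul_mem (add_mem (coordinate_mem_constantTermSums d) (one_mem _))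
        (constantTerm_comp_mem hΓ hS hχ (truncHom d) (truncHom_eq_zero d))
    · have hρ' : ρ - 1 ≠ 0 := sub_ne_zero.2 hρ
      have hS' : S / (ρ - 1) ∈ rationalHahn Γ K := div_mem hS (sub_mem (hχ _) (one_mem _))
      have h2 : ∀ n, directedSum 0 (n d) (fun k => (S * (χ (truncHom d n) * ρ ^ k)).coeff 0) =
          (S / (ρ - 1) * ρ * χ (truncHom (d + 1) n)).coeff 0 -
            (S / (ρ - 1) * χ (truncHom d n)).coeff 0 := by
        intro n
        have h3 := directedSum_sub
          (fun k : ℤ => (S / (ρ - 1) * χ (truncHom d n) * ρ ^ k).coeff 0) (n d)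
        rw [truncHom_succ, h1]
        convert h3 using 2
        · ext k
          rw [← coeff_sub]
          congr 1
          rw [zpow_add_one₀ hρ0]
          field_simp
        · rw [zpow_add_one₀ hρ0]
          congr 1
          ring
        · simp
      simp only [h2]
      exact sub_mem
        (constantTerm_comp_mem hΓ (mul_mem hS' (hχ _)) hχ (truncHom (d + 1)) (truncHom_eq_zero _))
        (constantTerm_comp_mem hΓ hS' hχ (truncHom d) (truncHom_eq_zero d))
  · simp only [Pi.zero_apply, directedSum_zero]
    exact zero_mem _
  · intro u v _ _ hu hv
    simp only [Pi.add_apply, directedSum_add]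
    exact add_mem hu hv
  · intro c u _ hu
    simp only [Pi.smul_apply, directedSum_smul]
    exact Subalgebra.smul_mem _ hu c

theorem binomialSums_le_constantTermSums : binomialSums K ≤ constantTermSums K :=
  (isLeast_binomialSums K).2
    { le_seqAlgebra := constantTermSums_le_seqAlgebra
      delta_mem := delta_mem_constantTermSums
      geom_mem := fun _ hC => geom_mem_constantTermSums hC
      choose_mem := choose_mem_constantTermSums
      affine_mem := fun _ _ φ _ hu => affine_mem_constantTermSums φ hu
      sum_mem := fun d _ hu => sum_mem_constantTermSums d hu }

/-- Along the multiples of the first unit vector a character is a sequence of powers, so each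
constant term has the form `[1] (x * y ^ n)`. -/
theorem IsBinomialSum.isRationalDiagonal {u : ℤ → K} (hu : IsBinomialSum u) :
    IsRationalDiagonal (PowerSeries.mk fun n : ℕ => u n) := by
  have key : ∀ f ∈ Submodule.span K (constantTermSeqs K),
      IsRationalDiagonal (PowerSeries.mk fun n : ℕ => f ((n : ℤ) • Pi.single 0 1)) := by
    intro f hf
    induction hf using Submodule.span_induction with
    | mem f h =>
      obtain ⟨Γ, _, _, _, hΓ, S, hS, χ, hχ, -, rfl⟩ := h
      simp only [AddChar.map_zsmul_eq_zpow, zpow_natCast]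
      exact isRationalDiagonal_coeff_zero_mul_pow hΓ hS (hχ _)
    | zero =>
      refine ⟨1, le_rfl, 0, by simpa using isRationalSeries_coe 0, ?_⟩
      ext
      simp [diag]
    | add f g _ _ hf hg =>
      convert hf.add hg using 1
      ext
      simp
    | smul c f _ hf =>
      convert hf.smul c using 1
      ext
      simp
  convert key _ (mem_constantTermSums.1 (binomialSums_le_constantTermSums hu)) using 3 with n
  simp [extend]

end ConstantTerms

/-! ### The two equivalences -/

section Main

variable {K : Type*} [Field K]

theorem isBinomialSum_of_isRationalDiagonal {u : ℕ → K}
    (hu : IsRationalDiagonal (PowerSeries.mk u)) :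
    IsBinomialSum fun n : ℤ => if 0 ≤ n then u n.toNat else 0 := by
  obtain ⟨d, -, R, hR, h⟩ := hu
  have := hR.isBinomialSum_diag
  rw [← h] at this
  simpa using this

theorem IsBinomialSum.isBinomialFun {u : ℤ → K} (hu : IsBinomialSum u) : IsBinomialFun u :=
  (IsBinomialFun.of_extend hu).comp_add (fun n (_ : Fin 1) => n) fun _ _ => rfl

theorem IsBinomialSum.comp_neg {u : ℤ → K} (hu : IsBinomialSum u) :
    IsBinomialSum fun n => u (-n) :=
  (hu.isBinomialFun.comp_add (fun n => -n) neg_add).isBinomialSum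

theorem isBinomialSumNat_iff (u : ℕ → K) :
    IsBinomialSumNat u ↔ IsRationalDiagonal (PowerSeries.mk u) := by
  constructor
  · rintro ⟨v, hv, -, h⟩
    simpa only [h] using hv.isRationalDiagonal
  · intro h
    exact ⟨_, isBinomialSum_of_isRationalDiagonal h, fun n hn => if_neg hn.not_ge,
      fun n => by simp⟩

theorem isBinomialSum_iff (u : ℤ → K) :
    IsBinomialSum u ↔ IsRationalDiagonal (PowerSeries.mk fun n : ℕ => u (n : ℤ)) ∧
      IsRationalDiagonal (PowerSeries.mk fun n : ℕ => u (-(n : ℤ))) := by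
  refine ⟨fun h => ⟨h.isRationalDiagonal, h.comp_neg.isRationalDiagonal⟩, fun ⟨h₁, h₂⟩ => ?_⟩
  have h3 := (isBinomialSum_of_isRationalDiagonal h₁).isBinomialFun
  have h4 := (isBinomialSum_of_isRationalDiagonal h₂).comp_neg.isBinomialFun
  -- Both one-sided halves contain the value at `0`, so one copy is subtracted.
  have h5 := (IsBinomialFun.const (-u 0)).mul (isBinomialFun_delta (K := K))
  convert ((h3.add h4).add h5).isBinomialSum using 2 with n
  rcases lt_trichotomy n 0 with hn | rfl | hn
  · simp [hn.not_ge, hn.ne, hn.le]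
  · simp
  · simp [hn.not_ge, hn.ne', hn.le]

end Main

end BinomialSum

end

theorem mainTheorem1 {K : Type*} [Field K] [CharZero K] :
    (∀ u : ℕ → K,
      BinomialSum.IsBinomialSumNat u ↔ BinomialSum.IsRationalDiagonal (PowerSeries.mk u)) ∧
    (∀ u : ℤ → K,
      BinomialSum.IsBinomialSum u ↔
        BinomialSum.IsRationalDiagonal (PowerSeries.mk fun n : ℕ => u (n : ℤ)) ∧
        BinomialSum.IsRationalDiagonal (PowerSeries.mk fun n : ℕ => u (-(n : ℤ)))) :=
  ⟨BinomialSum.isBinomialSumNat_iff, BinomialSum.isBinomialSum_iff⟩
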